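/- Let $p\ge 1$ be an integer, let $\varphi,\psi\in\mathbb{C}((u))$, and let $R$, $S$ be finite-dimensional $\mathbb{C}((u))$-vector spaces with regular connection, not both zero. (A connection on a vector space over a field of formal Laurent series in $u$ is given by an operator $\partial_u=\nabla_{\partial_u}$ satisfying the Leibniz rule; it is regular if in some basis the matrix of $u\partial_u$ has entries in $\mathbb{C}[[u]]$; an isomorphism is a linear bijection commuting with the connections.) Let $\mathcal{E}^{\varphi}$ be the space $\mathbb{C}((u))$ with the connection $d+d\varphi$, and let $\rho$ be the map $u\mapsto t=u^p$. For a $\mathbb{C}((u))$-vector space $N$ with connection, let $\rho_+N$ be the $\mathbb{C}((t))$-vector space with connection whose underlying additive group is $N$, on which $f(t)$ acts as multiplication by $f(u^p)$ and $\partial_t$ acts as $(pu^{p-1})^{-1}\partial_u$. Put $$\mathrm{El}([u\mapsto u^p],\varphi,R)=\rho_+(\mathcal{E}^{\varphi}\otimes_{\mathbb{C}((u))}R).$$ Then $\mathrm{El}([u\mapsto u^p],\varphi,R)\simeq\mathrm{El}([u\mapsto u^p],\psi,S)$ as $\mathbb{C}((t))$-vector spaces with connection if and only if both of the following hold: 1.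 there exists $\zeta\in\mathbb{C}$ with $\zeta^p=1$ such that $\psi(\zeta u)-\varphi(u)\in\mathbb{C}[[u]]$; 2. $S\simeq R$ as $\mathbb{C}((u))$-vector spaces with connection. -/

import Mathlib

open scoped LaurentSeries PowerSeries TensorProduct

universe u v

noncomputable section

namespace FormalConn

/-- The derivation `d/du` of the field `ℂ((u))` of formal Laurent series. -/
def D : ℂ⸨X⸩ →ₗ[ℂ] ℂ⸨X⸩ := LaurentSeries.derivative ℂ

theorem D_coeff (f : ℂ⸨X⸩) (n : ℤ) : (D f).coeff n = (n + 1 : ℂ) * f.coeff (n + 1) := by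
  simp [D, LaurentSeries.derivative_apply]

theorem coeff_single_one_mul (f : ℂ⸨X⸩) (n : ℤ) :
    ((HahnSeries.single (1 : ℤ) (1 : ℂ)) * f).coeff n = f.coeff (n - 1) := by
  rw [HahnSeries.coeff_single_mul, one_mul]

theorem coeff_uD (f : ℂ⸨X⸩) (n : ℤ) :
    ((HahnSeries.single (1 : ℤ) (1 : ℂ)) * D f).coeff n = (n : ℂ) * f.coeff n := by
  rw [coeff_single_one_mul, D_coeff]
  simp

theorem support_uD (f : ℂ⸨X⸩) :
    ((HahnSeries.single (1 : ℤ) (1 : ℂ)) * D f).support ⊆ f.support := by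
  intro n hn hf
  apply hn
  rw [coeff_uD, hf, mul_zero]

/-- The product rule in `ℂ((u))`. -/
theorem D_mul (f g : ℂ⸨X⸩) : D (f * g) = D f * g + f * D g := by
  have hu : (HahnSeries.single (1 : ℤ) (1 : ℂ)) ≠ 0 := by simp
  apply mul_left_cancel₀ hu
  have h1 : HahnSeries.single (1 : ℤ) (1 : ℂ) * (D f * g + f * D g) =
      (HahnSeries.single (1 : ℤ) (1 : ℂ) * D f) * g
        + f * (HahnSeries.single (1 : ℤ) (1 : ℂ) * D g) := by ring
  rw [h1]
  ext n
  rw [coeff_uD, HahnSeries.coeff_add, HahnSeries.coeff_mul,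
    HahnSeries.coeff_mul_left' f.isPWO_support (support_uD f),
    HahnSeries.coeff_mul_right' g.isPWO_support (support_uD g),
    ← Finset.sum_add_distrib, Finset.mul_sum]
  refine Finset.sum_congr rfl fun ij hij => ?_
  have h := (Finset.mem_antidiagonal.mp hij).2.2
  rw [coeff_uD, coeff_uD, ← h]
  push_cast
  ring

/-- The embedding `ℂ((t)) → ℂ((u))`, `f(t) ↦ f(u ^ p)`, attached to `ρ : u ↦ t = u ^ p`
(both fields are realized as `ℂ⸨X⸩`). -/
def ramify (p : ℕ) [NeZero p] : ℂ⸨X⸩ →+* ℂ⸨X⸩ :=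
  HahnSeries.embDomainRingHom (AddMonoidHom.mulLeft (p : ℤ))
    (fun a b h => by
      have hp : (p : ℤ) ≠ 0 := by exact_mod_cast NeZero.ne p
      exact mul_left_cancel₀ hp h)
    (fun a b => by
      have hp : (0 : ℤ) < p := by exact_mod_cast NeZero.pos p
      exact mul_le_mul_iff_right₀ hp)

theorem ramify_coeff_mul (p : ℕ) [NeZero p] (f : ℂ⸨X⸩) (n : ℤ) :
    (ramify p f).coeff (p * n) = f.coeff n :=
  HahnSeries.embDomain_coeff (f := ⟨⟨AddMonoidHom.mulLeft (p : ℤ), _⟩, _⟩)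

theorem ramify_coeff_of_not_dvd (p : ℕ) [NeZero p] (f : ℂ⸨X⸩) (n : ℤ) (h : ¬ (p : ℤ) ∣ n) :
    (ramify p f).coeff n = 0 := by
  apply HahnSeries.embDomain_of_notMem_range
  rintro ⟨m, rfl⟩
  exact h ⟨m, rfl⟩

/-- The derivative `ρ'(u) = p u ^ (p - 1)` of `ρ(u) = u ^ p`. -/
def rhoDeriv (p : ℕ) : ℂ⸨X⸩ := HahnSeries.single ((p : ℤ) - 1) (p : ℂ)

theorem rhoDeriv_ne_zero (p : ℕ) [NeZero p] : rhoDeriv p ≠ 0 := by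
  simp [rhoDeriv, NeZero.ne p]

/-- The chain rule `(f ∘ ρ)' = ρ' · (f' ∘ ρ)` for `ρ(u) = u ^ p`. -/
theorem D_ramify (p : ℕ) [NeZero p] (f : ℂ⸨X⸩) :
    D (ramify p f) = rhoDeriv p * ramify p (D f) := by
  ext n
  rw [D_coeff, rhoDeriv, HahnSeries.coeff_single_mul]
  by_cases h : (p : ℤ) ∣ n + 1
  · obtain ⟨m, hm⟩ := h
    have h2 : n - ((p : ℤ) - 1) = p * (m - 1) := by linear_combination hm
    have h3 : (n + 1 : ℂ) = p * m := by exact_mod_cast hm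
    rw [hm, h2, ramify_coeff_mul, ramify_coeff_mul, D_coeff, h3]
    push_cast
    rw [sub_add_cancel, sub_add_cancel]
    ring
  · rw [ramify_coeff_of_not_dvd p f _ h, ramify_coeff_of_not_dvd, mul_zero, mul_zero]
    intro h'
    apply h
    obtain ⟨m, hm⟩ := h'
    exact ⟨m + 1, by linear_combination hm⟩

/-- The composition `f ∘ μ_ζ`, i.e. `f(ζ u)`, where `μ_ζ : u ↦ ζ u` (used for `ζ ≠ 0`). -/
def compMu (ζ : ℂ) (f : ℂ⸨X⸩) : ℂ⸨X⸩ where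
  coeff n := ζ ^ n * f.coeff n
  isPWO_support' := f.isPWO_support.mono fun n hn hf => hn (by
    change ζ ^ n * f.coeff n = 0
    rw [hf, mul_zero])

/-- `f ≡ g mod ℂ[[u]]`. -/
def ModEqPowerSeries (f g : ℂ⸨X⸩) : Prop :=
  f - g ∈ Set.range ((↑) : ℂ⟦X⟧ → ℂ⸨X⸩)

end FormalConn

open FormalConn

/-- A vector space over the field of formal Laurent series in one variable, with a connection.
The connection is given by the operator `∂ = ∇_{d/du}`, which is additive and satisfies the
Leibniz rule (these two properties imply that `∂` is `ℂ`-linear, since constants have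
derivative zero). -/
structure ConnSpace : Type (u + 1) where
  carrier : Type u
  [addCommGroup : AddCommGroup carrier]
  [module : Module ℂ⸨X⸩ carrier]
  del : carrier →+ carrier
  leibniz : ∀ (f : ℂ⸨X⸩) (m : carrier), del (f • m) = D f • m + f • del m

namespace ConnSpace

instance : CoeSort ConnSpace.{u} (Type u) := ⟨ConnSpace.carrier⟩

instance (M : ConnSpace.{u}) : AddCommGroup M := M.addCommGroup

instance (M : ConnSpace.{u}) : Module ℂ⸨X⸩ M := M.module

/-- Two spaces with connection are isomorphic when there is a linear bijection between them that
commutes with the connections. -/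
def Isomorphic (M : ConnSpace.{u}) (N : ConnSpace.{v}) : Prop :=
  ∃ e : M ≃ₗ[ℂ⸨X⸩] N, ∀ m : M, e (M.del m) = N.del (e m)

/-- A connection is regular when, in some finite basis, the matrix of `u ∂_u` has
entries in `ℂ[[u]]` (the matrix of `∂_u` has at most simple poles). -/
def IsRegular (M : ConnSpace.{u}) : Prop :=
  ∃ (n : ℕ) (b : Module.Basis (Fin n) ℂ⸨X⸩ M) (A : Matrix (Fin n) (Fin n) ℂ⟦X⟧),
    ∀ j, (HahnSeries.single (1 : ℤ) (1 : ℂ) : ℂ⸨X⸩) • M.del (b j) =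
      ∑ i, ((A i j : ℂ⟦X⟧) : ℂ⸨X⸩) • b i

/-- The rank-one space `𝓔^φ`: the field itself with the connection `d + dφ`, so that
`∂ f = f' + φ' f`, in particular `∂ 1 = φ'`. -/
def expTwist (φ : ℂ⸨X⸩) : ConnSpace.{0} where
  carrier := ℂ⸨X⸩
  del := AddMonoidHom.mk' (fun f => D f + D φ * f) (fun f g => by
    rw [map_add]
    ring)
  leibniz f g := by
    simp only [AddMonoidHom.mk'_apply, smul_eq_mul, D_mul]
    ring

/-- The operator `∂ (m ⊗ n) = ∂ m ⊗ n + m ⊗ ∂ n` on the tensor product. -/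
def tensorDel (M : ConnSpace.{u}) (N : ConnSpace.{v}) : M ⊗[ℂ⸨X⸩] N →+ M ⊗[ℂ⸨X⸩] N :=
  TensorProduct.liftAddHom
    (AddMonoidHom.mk' (fun m : M => AddMonoidHom.mk'
      (fun n : N => M.del m ⊗ₜ[ℂ⸨X⸩] n + m ⊗ₜ[ℂ⸨X⸩] N.del n)
      (fun n n' => by
        simp only [map_add, TensorProduct.tmul_add]
        abel))
      (fun m m' => by
        ext n
        simp only [map_add, TensorProduct.add_tmul, AddMonoidHom.mk'_apply,
          AddMonoidHom.add_apply]
        abel))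
    (fun f m n => by
      simp only [AddMonoidHom.mk'_apply, M.leibniz, N.leibniz, TensorProduct.add_tmul,
        TensorProduct.tmul_add, TensorProduct.smul_tmul]
      abel)

theorem tensorDel_tmul (M : ConnSpace.{u}) (N : ConnSpace.{v}) (m : M) (n : N) :
    tensorDel M N (m ⊗ₜ[ℂ⸨X⸩] n) = M.del m ⊗ₜ[ℂ⸨X⸩] n + m ⊗ₜ[ℂ⸨X⸩] N.del n := rfl

/-- The tensor product of two spaces with connection. -/
def tensor (M : ConnSpace.{u}) (N : ConnSpace.{v}) : ConnSpace.{max u v} where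
  carrier := M ⊗[ℂ⸨X⸩] N
  del := tensorDel M N
  leibniz f x := by
    induction x with
    | zero => simp
    | tmul m n =>
      rw [TensorProduct.smul_tmul', tensorDel_tmul, tensorDel_tmul, M.leibniz,
        TensorProduct.add_tmul, smul_add, TensorProduct.smul_tmul', TensorProduct.smul_tmul',
        TensorProduct.smul_tmul', add_assoc]
    | add x y hx hy =>
      rw [smul_add, map_add, hx, hy, map_add, smul_add, smul_add]
      abel

/-- The push-forward `ρ_+ N` by `ρ : u ↦ t = u ^ p`: the same additive group `N`, on which
`f(t)` acts as `f(u ^ p)`, with `∂_t = ρ'(u)⁻¹ ∂_u`. -/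
def pushForward (p : ℕ) [NeZero p] (N : ConnSpace.{u}) : ConnSpace.{u} where
  carrier := N
  module := Module.compHom N (ramify p)
  del := AddMonoidHom.mk' (fun m => (rhoDeriv p)⁻¹ • N.del m) (fun m m' => by
    rw [map_add, smul_add])
  leibniz f m := by
    change (rhoDeriv p)⁻¹ • N.del (ramify p f • m) =
      ramify p (D f) • m + ramify p f • ((rhoDeriv p)⁻¹ • N.del m)
    rw [N.leibniz, D_ramify, smul_add, smul_smul, smul_smul, smul_smul,
      inv_mul_cancel_left₀ (rhoDeriv_ne_zero p), mul_comm (ramify p f)]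

/-- The elementary formal connection `El([u ↦ u ^ p], φ, R) = ρ_+ (𝓔^φ ⊗ R)`. -/
def El (p : ℕ) [NeZero p] (φ : ℂ⸨X⸩) (R : ConnSpace.{u}) : ConnSpace.{u} :=
  pushForward p (tensor (expTwist φ) R)

end ConnSpace

end

-- Write `θ = u ∂_u`. Since `u ∂_u = p t ∂_t`, an isomorphism of the two push-forwards is an
-- additive bijection `R → S` that is linear over `ℂ((u^p))` and intertwines `θ + θ(φ)` with `θ +
-- θ(ψ)` (`isomorphic_El_iff`).
--
-- Three facts about connections carry the proof. A regular `M` is isomorphic to its pullback by `u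
-- ↦ ζ u`: on a lattice where `θ` has coefficients in `ℂ[[u]]`, the operator `exp (c θ)` with `e^c =
-- ζ` makes sense, commutes with `θ`, and is semilinear along `u ↦ ζ u` (`exists_monodromy`). If `h`
-- lies in `ℂ[[u]]`, then `𝓔^h` is trivialized by an exponential (`exists_theta_eq_mul`). If `h` has
-- a pole, there is no nonzero morphism between regular connections twisted by exponents that differ
-- by `h`, by comparison of lowest-order terms (`eq_zero_of_pole`).
--
-- The first two facts give the "if" direction. Conversely, pulling an isomorphism back by `ρ` gives
-- an isomorphism `R^p ≃ S^p` between the sums of the twists by `φ(ω^{-k} u)` and by `ψ(ω^{-k} u)`,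
-- with `ω` a primitive `p`-th root of unity (`exists_conjugates_equiv`). If no `ψ(ζ u)` were
-- congruent to `φ`, all blocks out of the summand `k = 0` would vanish, against injectivity. So a
-- suitable `ζ` exists, and `ψ` may be replaced by `φ`. The isomorphism then preserves the part
-- formed by the `k` with `φ(ω^{-k} u) ≡ φ`. After untwisting, this part is `R^n ≃ S^n` with `n ≥
-- 1`, and a Krull–Schmidt argument in the category of connections gives `R ≃ S`.

universe w

noncomputable section

open FormalConn

/-! ### Krull–Schmidt: extracting `n`-th roots of direct sums of modules of finite length. -/

section KrullSchmidt

variable {A : Type*} [Ring A]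

/-- Fitting's lemma: for large `n` the module is `ker fⁿ ⊕ range fⁿ`. If the kernel vanishes, `f` is
bijective by the artinian condition; if the range vanishes, `f` is nilpotent and `1 - f` is a unit.
-/
theorem Module.End.isLocalRing_of_indecomposable {X : Type*} [AddCommGroup X] [Module A X]
    [IsArtinian A X] [IsNoetherian A X] [Nontrivial X]
    (hX : ∀ p q : Submodule A X, IsCompl p q → p = ⊥ ∨ q = ⊥) :
    IsLocalRing (Module.End A X) := by
  refine IsLocalRing.of_isUnit_or_isUnit_one_sub_self fun f => ?_
  obtain ⟨n, hn, hn0⟩ := ((LinearMap.eventually_isCompl_ker_pow_range_pow f).and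
    (Filter.eventually_gt_atTop 0)).exists
  rcases hX _ _ hn with h | h
  · left
    have hi : Function.Injective (f ^ n) := LinearMap.ker_eq_bot.mp h
    have hu : IsUnit (f ^ n) :=
      (Module.End.isUnit_iff _).mpr (IsArtinian.bijective_of_injective_endomorphism _ hi)
    exact (isUnit_pow_iff hn0.ne').mp hu
  · right
    have h0 : f ^ n = 0 := LinearMap.range_eq_bot.mp h
    exact IsNilpotent.isUnit_one_sub ⟨n, h0⟩

/-- A minimal nonzero direct summand works: in a nontrivial splitting `X = p ⊕ q`, the part `p`
would be a smaller summand, with complement `q ⊔ Y`. -/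
theorem Submodule.exists_indecomposable_isCompl (M : Type*) [AddCommGroup M] [Module A M]
    [IsArtinian A M] [IsNoetherian A M] [Nontrivial M] :
    ∃ X Y : Submodule A M, IsCompl X Y ∧ X ≠ ⊥ ∧ IsLocalRing (Module.End A X) := by
  obtain ⟨X, ⟨hX0, Y, hXY⟩, hmin⟩ := IsArtinian.set_has_minimal
    {X : Submodule A M | X ≠ ⊥ ∧ ∃ Y, IsCompl X Y} ⟨⊤, top_ne_bot, ⊥, isCompl_top_bot⟩
  refine ⟨X, Y, hXY, hX0, ?_⟩
  have : Nontrivial X := Submodule.nontrivial_iff_ne_bot.mpr hX0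
  refine Module.End.isLocalRing_of_indecomposable fun p q hpq => ?_
  by_contra! hne
  have hsup : p.map X.subtype ⊔ q.map X.subtype = X := by
    rw [← Submodule.map_sup, hpq.sup_eq_top, Submodule.map_subtype_top]
  have hdis : Disjoint (p.map X.subtype) (q.map X.subtype) :=
    Submodule.disjoint_map X.injective_subtype hpq.disjoint
  refine hmin (p.map X.subtype) ⟨?_, q.map X.subtype ⊔ Y, ?_, ?_⟩ ?_
  · intro h
    exact hne.1 (Submodule.map_injective_of_injective X.injective_subtype (h.trans (Submodule.map_bot _).symm))
  · exact hdis.disjoint_sup_right_of_disjoint_sup_left (hsup.symm ▸ hXY.disjoint)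
  · rw [codisjoint_iff, ← sup_assoc, hsup, hXY.sup_eq_top]
  · refine lt_of_le_of_ne (Submodule.map_subtype_le X p) fun h => hne.2 ?_
    rw [h] at hdis
    exact Submodule.map_injective_of_injective X.injective_subtype
      ((le_bot_iff.mp (hdis (Submodule.map_subtype_le X q) le_rfl)).trans (Submodule.map_bot _).symm)

/-- Gaussian elimination with the invertible corner `a` as pivot. The isomorphism is the Schur
complement `p ↦ (F (s p, p)).2`, where `s p` is chosen to kill the `X`-component; its inverse is the
`Q → P` corner of `F⁻¹`. -/
theorem LinearEquiv.nonempty_of_prod_of_isUnit {X P Q : Type*} [AddCommGroup X] [Module A X]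
    [AddCommGroup P] [Module A P] [AddCommGroup Q] [Module A Q] (F : (X × P) ≃ₗ[A] (X × Q))
    (a : Module.End A X) (ha : a = LinearMap.fst A X Q ∘ₗ F.toLinearMap ∘ₗ LinearMap.inl A X P)
    (hu : IsUnit a) : Nonempty (P ≃ₗ[A] Q) := by
  obtain ⟨w, hw⟩ := hu
  have hinv : ∀ x, (↑w⁻¹ : Module.End A X) (F (x, 0)).1 = x := fun x => by
    have : a x = (F (x, 0)).1 := by rw [ha]; rfl
    rw [← this, ← hw]
    exact LinearMap.congr_fun w.inv_mul x
  have hinv' : ∀ x, (F ((↑w⁻¹ : Module.End A X) x, 0)).1 = x := fun x => by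
    have : a ((↑w⁻¹ : Module.End A X) x) = (F ((↑w⁻¹ : Module.End A X) x, 0)).1 := by rw [ha]; rfl
    rw [← this, ← hw]
    exact LinearMap.congr_fun w.mul_inv x
  have hsplit : ∀ x p, F (x, p) = F (x, 0) + F (0, p) := fun x p => by
    rw [← map_add]; simp
  let s : P →ₗ[A] X := -((↑w⁻¹ : Module.End A X) ∘ₗ LinearMap.fst A X Q ∘ₗ F.toLinearMap ∘ₗ
    LinearMap.inr A X P)
  have hs : ∀ p, s p = -(↑w⁻¹ : Module.End A X) (F (0, p)).1 := fun p => rfl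
  have hF : ∀ p, (F (s p, p)).1 = 0 := fun p => by
    rw [hsplit, Prod.fst_add, hs, ← map_neg, hinv', neg_add_cancel]
  let f : P →ₗ[A] Q := LinearMap.snd A X Q ∘ₗ F.toLinearMap ∘ₗ (s.prod LinearMap.id)
  let g : Q →ₗ[A] P := LinearMap.snd A X P ∘ₗ F.symm.toLinearMap ∘ₗ LinearMap.inr A X Q
  have hf : ∀ p, f p = (F (s p, p)).2 := fun p => rfl
  have hg : ∀ q, g q = (F.symm (0, q)).2 := fun q => rfl
  refine ⟨LinearEquiv.ofLinearMap f g (LinearMap.ext fun q => ?_) (LinearMap.ext fun p => ?_)⟩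
  · have h1 : F (F.symm (0, q)) = (0, q) := F.apply_symm_apply _
    have h2 : s (g q) = (F.symm (0, q)).1 := by
      have h3 : F (0, g q) = (0, q) - F ((F.symm (0, q)).1, 0) := by
        rw [eq_sub_iff_add_eq', ← hsplit, hg]
        exact h1
      rw [hs, h3, Prod.fst_sub, zero_sub, map_neg, neg_neg, hinv]
    rw [LinearMap.comp_apply, hf, h2, hg]
    exact congrArg Prod.snd h1
  · have h1 : F (s p, p) = (0, f p) := Prod.ext (hF p) rfl
    rw [LinearMap.comp_apply, hg, ← h1, F.symm_apply_apply]
    rfl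

theorem LinearEquiv.nonempty_of_prod_of_isLocalRing {X P Q : Type*} [AddCommGroup X] [Module A X]
    [IsArtinian A X] [AddCommGroup P] [Module A P] [AddCommGroup Q] [Module A Q]
    [IsLocalRing (Module.End A X)]
    (F : (X × P) ≃ₗ[A] (X × Q)) : Nonempty (P ≃ₗ[A] Q) := by
  let a : Module.End A X := LinearMap.fst A X Q ∘ₗ F.toLinearMap ∘ₗ LinearMap.inl A X P
  let a' : Module.End A X := LinearMap.fst A X P ∘ₗ F.symm.toLinearMap ∘ₗ LinearMap.inl A X Q
  let b' : Q →ₗ[A] X := LinearMap.fst A X P ∘ₗ F.symm.toLinearMap ∘ₗ LinearMap.inr A X Q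
  let c : X →ₗ[A] Q := LinearMap.snd A X Q ∘ₗ F.toLinearMap ∘ₗ LinearMap.inl A X P
  by_cases hu : IsUnit a
  · exact LinearEquiv.nonempty_of_prod_of_isUnit F a rfl hu
  -- This is the `X`-corner of `F⁻¹ F = 1`. By locality one summand is a unit; were it `a' * a`,
  -- then `a` would be injective, hence a unit. So `b' ∘ₗ c` is a unit, and adding the nonunit `a`
  -- keeps it one.
  · have hsum : a' * a + b' ∘ₗ c = 1 := by
      ext x
      change (F.symm ((F (x, 0)).1, 0)).1 + (F.symm (0, (F (x, 0)).2)).1 = x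
      rw [← Prod.fst_add, ← map_add]
      simp
    have hbc : IsUnit (b' ∘ₗ c : Module.End A X) := by
      rcases IsLocalRing.isUnit_or_isUnit_of_add_one hsum with h | h
      · refine absurd ((Module.End.isUnit_iff _).mpr
          (IsArtinian.bijective_of_injective_endomorphism a ?_)) hu
        have := ((Module.End.isUnit_iff _).mp h).1
        exact Function.Injective.of_comp (f := a') this
      · exact h
    have hab : IsUnit (a + b' ∘ₗ c) := by
      have h1 : IsUnit ((a + b' ∘ₗ c) + -a) := by rwa [add_neg_cancel_comm]
      exact (IsLocalRing.isUnit_or_isUnit_of_isUnit_add h1).resolve_right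
        fun h => hu (IsUnit.neg_iff a |>.mp h)
    -- The shear `(x, q) ↦ (x + b' q, q)`; composing `F` with it changes the corner from `a` to the
    -- unit `a + b' ∘ₗ c`.
    let T : (X × Q) ≃ₗ[A] (X × Q) :=
      LinearEquiv.ofLinearMap
        ((LinearMap.fst A X Q + b' ∘ₗ LinearMap.snd A X Q).prod (LinearMap.snd A X Q))
        ((LinearMap.fst A X Q - b' ∘ₗ LinearMap.snd A X Q).prod (LinearMap.snd A X Q))
        (LinearMap.ext fun x => Prod.ext (by simp) (by simp))
        (LinearMap.ext fun x => Prod.ext (by simp) (by simp))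
    exact LinearEquiv.nonempty_of_prod_of_isUnit (F.trans T) (a + b' ∘ₗ c) rfl hab

theorem LinearEquiv.nonempty_of_pi_prod_of_isLocalRing {X P Q : Type*} [AddCommGroup X]
    [Module A X] [IsArtinian A X] [AddCommGroup P] [Module A P] [AddCommGroup Q] [Module A Q]
    [IsLocalRing (Module.End A X)] (n : ℕ) (F : ((Fin n → X) × P) ≃ₗ[A] ((Fin n → X) × Q)) :
    Nonempty (P ≃ₗ[A] Q) := by
  induction n with
  | zero =>
    exact ⟨(LinearEquiv.uniqueProd (M := P) (M₂ := Fin 0 → X)).symm ≪≫ₗ F ≪≫ₗ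
      LinearEquiv.uniqueProd⟩
  | succ n ih =>
    let C := Fin.consLinearEquiv A (fun _ : Fin (n + 1) => X)
    obtain ⟨G⟩ := LinearEquiv.nonempty_of_prod_of_isLocalRing
      ((LinearEquiv.prodAssoc A X (Fin n → X) P).symm ≪≫ₗ
        (C.prodCongr (LinearEquiv.refl A P)) ≪≫ₗ F ≪≫ₗ
        (C.prodCongr (LinearEquiv.refl A Q)).symm ≪≫ₗ LinearEquiv.prodAssoc A X (Fin n → X) Q)
    exact ih G

theorem LinearMap.exists_isCompl_of_isUnit_comp {X N : Type*} [AddCommGroup X] [Module A X]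
    [AddCommGroup N] [Module A N] (α : X →ₗ[A] N) (β : N →ₗ[A] X)
    (h : IsUnit (β ∘ₗ α : Module.End A X)) :
    ∃ N' : Submodule A N, Nonempty (N ≃ₗ[A] X × N') := by
  have hb := (Module.End.isUnit_iff _).mp h
  let e : X ≃ₗ[A] X := LinearEquiv.ofBijective (β ∘ₗ α) hb
  let γ : N →ₗ[A] X := e.symm.toLinearMap ∘ₗ β
  have hγ : ∀ x, γ (α x) = x := fun x => e.symm_apply_apply x
  have hα : Function.Injective α := Function.LeftInverse.injective hγ
  have hc : IsCompl (LinearMap.range α) (LinearMap.ker γ) := by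
    have h1 := LinearMap.isCompl_of_proj
      (f := (LinearEquiv.ofInjective α hα).toLinearMap ∘ₗ γ) (by
        rintro ⟨_, x, rfl⟩
        ext
        simp [hγ])
    rwa [LinearEquiv.ker_comp] at h1
  exact ⟨LinearMap.ker γ, ⟨(Submodule.prodEquivOfIsCompl _ _ hc).symm ≪≫ₗ
    ((LinearEquiv.ofInjective α hα).symm.prodCongr (LinearEquiv.refl A _))⟩⟩

theorem LinearEquiv.nonempty_pi_prod (X P : Type*) [AddCommGroup X] [Module A X] [AddCommGroup P]
    [Module A P] (n : ℕ) : Nonempty ((Fin n → X × P) ≃ₗ[A] (Fin n → X) × (Fin n → P)) :=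
  ⟨{ toFun := fun g => (fun i => (g i).1, fun i => (g i).2)
     invFun := fun g i => (g.1 i, g.2 i)
     map_add' := fun _ _ => rfl
     map_smul' := fun _ _ => rfl
     left_inv := fun _ => rfl
     right_inv := fun _ => rfl }⟩

/-- For modules of finite length, `Mⁿ ≃ Nⁿ` with `n ≠ 0` implies `M ≃ N`. -/
theorem LinearEquiv.nonempty_of_pi {M : Type u} [AddCommGroup M] [Module A M] [IsArtinian A M]
    [IsNoetherian A M] {N : Type v} [AddCommGroup N] [Module A N] {n : ℕ} (hn : n ≠ 0)
    (F : (Fin n → M) ≃ₗ[A] (Fin n → N)) : Nonempty (M ≃ₗ[A] N) := by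
  -- Ranging over submodules of one fixed `M` makes well-founded induction available, while `N`
  -- stays arbitrary.
  suffices H : ∀ (M' : Submodule A M) (N : Type v) [AddCommGroup N] [Module A N],
      ((Fin n → M') ≃ₗ[A] (Fin n → N)) → Nonempty (M' ≃ₗ[A] N) by
    obtain ⟨G⟩ := H ⊤ N (LinearEquiv.piCongrRight (fun _ => Submodule.topEquiv) ≪≫ₗ F)
    exact ⟨Submodule.topEquiv.symm ≪≫ₗ G⟩
  intro M'
  induction M' using WellFoundedLT.induction with
  | ind M' ih =>
    intro N _ _ F
    let i0 : Fin n := ⟨0, Nat.pos_of_ne_zero hn⟩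
    rcases subsingleton_or_nontrivial M' with hM | hM
    · have : Subsingleton N := by
        refine ⟨fun a b => ?_⟩
        have : (fun _ : Fin n => a) = fun _ => b := F.symm.injective (Subsingleton.elim _ _)
        exact congrFun this i0
      exact ⟨0, 0, fun _ => Subsingleton.elim _ _, fun _ => Subsingleton.elim _ _⟩
    obtain ⟨X, Y, hXY, hX0, hloc⟩ := Submodule.exists_indecomposable_isCompl (A := A) M'
    have hY : Y.map M'.subtype < M' := by
      refine lt_of_le_of_ne (Submodule.map_subtype_le M' Y) fun h => hX0 ?_
      have : Y = ⊤ := by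
        apply Submodule.map_injective_of_injective M'.injective_subtype
        rw [h, Submodule.map_subtype_top]
      have h2 := hXY.disjoint
      rwa [this, disjoint_top] at h2
    let E1 : M' ≃ₗ[A] X × Y := (Submodule.prodEquivOfIsCompl X Y hXY).symm
    let ι : X →ₗ[A] (Fin n → M') := LinearMap.single A (fun _ => M') i0 ∘ₗ X.subtype
    let π : (Fin n → M') →ₗ[A] X := LinearMap.fst A X Y ∘ₗ E1.toLinearMap ∘ₗ LinearMap.proj i0
    have hπι : ∀ x, π (ι x) = x := fun x => by
      simp [π, ι, E1]
    let α : Fin n → (X →ₗ[A] N) := fun i => LinearMap.proj i ∘ₗ F.toLinearMap ∘ₗ ι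
    let β : Fin n → (N →ₗ[A] X) := fun i =>
      π ∘ₗ F.symm.toLinearMap ∘ₗ LinearMap.single A (fun _ => N) i
    -- The identity of `X` factors through `Nⁿ`. Locality makes some `β i ∘ₗ α i` a unit, so `X`
    -- splits off `N` too; then `Xⁿ` is cancelled and the induction applies to `Y`.
    have hsum : ∑ i, (β i ∘ₗ α i : Module.End A X) = 1 := by
      refine LinearMap.ext fun x => ?_
      rw [LinearMap.sum_apply]
      change ∑ i, π (F.symm (Pi.single i (F (ι x) i))) = x
      rw [← map_sum, ← map_sum, Finset.univ_sum_single, F.symm_apply_apply, hπι]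
    obtain ⟨i, -, hi⟩ := IsLocalRing.exists_of_isUnit_sum (hsum.symm ▸ isUnit_one)
    obtain ⟨N', ⟨E2⟩⟩ := LinearMap.exists_isCompl_of_isUnit_comp (α i) (β i) hi
    obtain ⟨P1⟩ := LinearEquiv.nonempty_pi_prod (A := A) X Y n
    obtain ⟨P2⟩ := LinearEquiv.nonempty_pi_prod (A := A) X N' n
    obtain ⟨G⟩ := LinearEquiv.nonempty_of_pi_prod_of_isLocalRing n
      (P1.symm ≪≫ₗ LinearEquiv.piCongrRight (fun _ => E1.symm) ≪≫ₗ F ≪≫ₗ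
        LinearEquiv.piCongrRight (fun _ => E2) ≪≫ₗ P2)
    let E3 : Y ≃ₗ[A] Y.map M'.subtype := M'.equivSubtypeMap Y
    obtain ⟨H⟩ := ih _ hY N' (LinearEquiv.piCongrRight (fun _ => E3.symm) ≪≫ₗ G)
    exact ⟨E1 ≪≫ₗ ((LinearEquiv.refl A X).prodCongr (E3 ≪≫ₗ H)) ≪≫ₗ E2.symm⟩

end KrullSchmidt

/-! ### Laurent series: the derivation `θ`, the substitution `u ↦ ζ u`, and ramification. -/

namespace FormalConn

/-- The derivation `u d/du` of `ℂ((u))`. -/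
def theta (f : ℂ⸨X⸩) : ℂ⸨X⸩ := HahnSeries.single (1 : ℤ) (1 : ℂ) * D f

theorem coeff_theta (f : ℂ⸨X⸩) (n : ℤ) : (theta f).coeff n = (n : ℂ) * f.coeff n :=
  coeff_uD f n

theorem theta_sub (f g : ℂ⸨X⸩) : theta (f - g) = theta f - theta g := by
  simp only [theta, map_sub, mul_sub]

theorem compMu_coeff (ζ : ℂ) (f : ℂ⸨X⸩) (n : ℤ) :
    (compMu ζ f).coeff n = ζ ^ n * f.coeff n := rfl

theorem compMu_mul {ζ : ℂ} (hζ : ζ ≠ 0) (f g : ℂ⸨X⸩) :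
    compMu ζ (f * g) = compMu ζ f * compMu ζ g := by
  have hs : ∀ f : ℂ⸨X⸩, (compMu ζ f).support = f.support := fun f => by
    ext n
    simp only [HahnSeries.mem_support, compMu_coeff, ne_eq, mul_eq_zero, zpow_ne_zero n hζ,
      false_or]
  ext n
  rw [compMu_coeff, HahnSeries.coeff_mul, HahnSeries.coeff_mul, Finset.mul_sum]
  refine Finset.sum_congr (by ext; simp only [Finset.mem_antidiagonal, hs]) fun ij hij => ?_
  rw [compMu_coeff, compMu_coeff, ← (Finset.mem_antidiagonal.mp hij).2.2, zpow_add₀ hζ]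
  ring

/-- `f(u) ↦ f(ζ u)` as a ring homomorphism. -/
def compMuHom (ζ : ℂˣ) : ℂ⸨X⸩ →+* ℂ⸨X⸩ where
  toFun := compMu ζ
  map_one' := by
    ext n
    rw [compMu_coeff]
    by_cases h : n = 0
    · simp [h]
    · simp [HahnSeries.coeff_one, h]
  map_mul' := compMu_mul ζ.ne_zero
  map_zero' := by
    ext n
    simp [compMu_coeff]
  map_add' f g := by
    ext n
    simp [compMu_coeff, mul_add]

theorem compMuHom_apply (ζ : ℂˣ) (f : ℂ⸨X⸩) : compMuHom ζ f = compMu ζ f := rfl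

theorem compMuHom_compMuHom (ζ η : ℂˣ) (f : ℂ⸨X⸩) :
    compMuHom ζ (compMuHom η f) = compMuHom (ζ * η) f := by
  ext n
  simp only [compMuHom_apply, compMu_coeff, Units.val_mul, mul_zpow, mul_assoc]

theorem compMuHom_one (f : ℂ⸨X⸩) : compMuHom 1 f = f := by
  ext n
  simp [compMuHom_apply, compMu_coeff]

theorem theta_compMuHom (ζ : ℂˣ) (f : ℂ⸨X⸩) : theta (compMuHom ζ f) = compMuHom ζ (theta f) := by
  ext n
  simp only [compMuHom_apply, compMu_coeff, coeff_theta]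
  ring

theorem compMuHom_single (ζ : ℂˣ) (n : ℤ) (a : ℂ) :
    compMuHom ζ (HahnSeries.single n a) = HahnSeries.single n ((ζ : ℂ) ^ n * a) := by
  ext m
  rw [compMuHom_apply, compMu_coeff]
  by_cases h : m = n
  · simp [h]
  · simp [HahnSeries.coeff_single_of_ne h]

theorem compMuHom_ramify (p : ℕ) [NeZero p] {ζ : ℂˣ} (hζ : ζ ^ p = 1) (f : ℂ⸨X⸩) :
    compMuHom ζ (ramify p f) = ramify p f := by
  ext n
  rw [compMuHom_apply, compMu_coeff]
  by_cases h : (p : ℤ) ∣ n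
  · obtain ⟨m, rfl⟩ := h
    have : (ζ : ℂ) ^ ((p : ℤ) * m) = 1 := by
      rw [zpow_mul, zpow_natCast, ← Units.val_pow_eq_pow_val, hζ, Units.val_one, one_zpow]
    rw [this, one_mul]
  · rw [ramify_coeff_of_not_dvd p f n h, mul_zero]

theorem mem_range_coe_iff (f : ℂ⸨X⸩) :
    f ∈ Set.range ((↑) : ℂ⟦X⟧ → ℂ⸨X⸩) ↔ ∀ n : ℤ, n < 0 → f.coeff n = 0 := by
  constructor
  · rintro ⟨g, rfl⟩ n hn
    rw [PowerSeries.coeff_coe, if_pos hn]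
  · intro h
    refine ⟨PowerSeries.mk fun n => f.coeff n, ?_⟩
    ext n
    rw [PowerSeries.coeff_coe]
    split_ifs with hn
    · exact (h n hn).symm
    · rw [PowerSeries.coeff_mk, Int.natAbs_of_nonneg (not_lt.mp hn)]

theorem theta_coe (f : ℂ⟦X⟧) :
    theta (f : ℂ⸨X⸩) = ((PowerSeries.X * PowerSeries.derivative ℂ f : ℂ⟦X⟧) : ℂ⸨X⸩) := by
  ext n
  rw [coeff_theta, PowerSeries.coeff_coe, PowerSeries.coeff_coe]
  split_ifs with hn
  · rw [mul_zero]
  · obtain ⟨m, rfl⟩ := Int.eq_ofNat_of_zero_le (not_lt.mp hn)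
    cases m with
    | zero => simp
    | succ m =>
      rw [Int.natAbs_natCast, PowerSeries.coeff_succ_X_mul, PowerSeries.coeff_derivative, mul_comm]
      push_cast
      rfl

/-- The connection `𝓔^h` is trivial for `h ∈ ℂ[[u]]`. -/
theorem exists_theta_eq_mul (h : ℂ⸨X⸩) (hh : h ∈ Set.range ((↑) : ℂ⟦X⟧ → ℂ⸨X⸩)) :
    ∃ g : ℂ⸨X⸩, g ≠ 0 ∧ theta g = theta h * g := by
  obtain ⟨h, rfl⟩ := hh
  -- Removing the constant term leaves the derivative unchanged and allows substitution into `exp`;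
  -- the solution is `g = exp (h - h(0))`.
  let h0 : ℂ⟦X⟧ := h - PowerSeries.C (PowerSeries.constantCoeff h)
  have h1 : PowerSeries.constantCoeff h0 = 0 := by simp [h0]
  have hs : PowerSeries.HasSubst h0 := PowerSeries.HasSubst.of_constantCoeff_zero' h1
  have hd : PowerSeries.derivative ℂ h0 = PowerSeries.derivative ℂ h := by
    ext n
    simp [h0, PowerSeries.coeff_derivative]
  let g : ℂ⟦X⟧ := (PowerSeries.exp ℂ).subst h0
  have hg : PowerSeries.derivative ℂ g = g * PowerSeries.derivative ℂ h := by
    rw [PowerSeries.derivative_subst hs, PowerSeries.derivative_exp, hd]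
  have hg0 : g ≠ 0 := by
    intro h2
    have : PowerSeries.constantCoeff g = 1 := by
      have h3 : g = 1 + (PowerSeries.exp ℂ - 1).subst h0 := by
        rw [← PowerSeries.coe_substAlgHom hs, map_sub, map_one, PowerSeries.coe_substAlgHom]
        simp [g]
      have h4 := PowerSeries.constantCoeff_subst_eq_zero h1 (PowerSeries.exp ℂ - 1) (by simp)
      rw [h3, map_add, map_one]
      exact (congrArg _ h4).trans (add_zero 1)
    rw [h2, map_zero] at this
    exact zero_ne_one this
  refine ⟨g, ?_, ?_⟩
  · intro h2
    exact hg0 (HahnSeries.ofPowerSeries_injective (h2.trans PowerSeries.coe_zero.symm))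
  · rw [theta_coe, theta_coe, hg, ← PowerSeries.coe_mul]
    congr 1
    ring

/-- The powers `1, u, …, u^(p-1)` span `ℂ((u))` over `ℂ((u^p))`: sort the coefficients by the
residue of the exponent mod `p`. -/
theorem exists_eq_sum_ramify (p : ℕ) [NeZero p] (f : ℂ⸨X⸩) :
    ∃ c : ℕ → ℂ⸨X⸩, f = ∑ j ∈ Finset.range p,
      HahnSeries.single (j : ℤ) (1 : ℂ) * ramify p (c j) := by
  have hp : (0 : ℤ) < p := by exact_mod_cast NeZero.pos p
  have hpwo : ∀ j : ℕ, (Function.support fun n : ℤ => f.coeff (p * n + j)).IsPWO := fun j => by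
    refine (BddBelow.isWF ⟨-|f.order| - j, fun n hn => ?_⟩).isPWO
    have h1 : f.order ≤ p * n + j := HahnSeries.order_le_of_coeff_ne_zero hn
    have h2 := neg_abs_le f.order
    have h3 := abs_nonneg f.order
    by_contra! h4
    nlinarith
  refine ⟨fun j => ⟨fun n => f.coeff (p * n + j), hpwo j⟩, ?_⟩
  ext n
  rw [HahnSeries.coeff_sum]
  have hmod := Int.emod_add_mul_ediv n p
  have hnn := Int.emod_nonneg n hp.ne'
  have hlt := Int.emod_lt_of_pos n hp
  rw [Finset.sum_eq_single_of_mem (n % p).toNat]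
  · rw [HahnSeries.coeff_single_mul, one_mul, Int.toNat_of_nonneg hnn,
      show n - n % p = p * (n / p) by linarith, ramify_coeff_mul]
    change _ = f.coeff _
    rw [Int.toNat_of_nonneg hnn, add_comm, hmod]
  · rw [Finset.mem_range]
    omega
  · intro j hj hne
    rw [HahnSeries.coeff_single_mul, one_mul, ramify_coeff_of_not_dvd]
    intro hd
    apply hne
    have : n % p = j := by
      rw [Int.emod_eq_emod_iff_emod_sub_eq_zero.mpr (Int.emod_eq_zero_of_dvd hd)]
      exact Int.emod_eq_of_lt (by positivity) (by exact_mod_cast Finset.mem_range.mp hj)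
    omega

end FormalConn

/-! ### Exponentials of operators that preserve the `X`-adic filtration. -/

theorem ContinuousLinearMap.comp_exp_apply {V W : Type*} [NormedAddCommGroup V] [NormedSpace ℂ V]
    [CompleteSpace V] [NormedAddCommGroup W] [NormedSpace ℂ W] [CompleteSpace W]
    (S : V →L[ℂ] W) (a : V →L[ℂ] V) (b : W →L[ℂ] W) (h : ∀ x, S (a x) = b (S x)) (x : V) :
    S (NormedSpace.exp a x) = NormedSpace.exp b (S x) := by
  have hpow : ∀ (k : ℕ) (x : V), S ((a ^ k) x) = (b ^ k) (S x) := fun k => by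
    induction k with
    | zero => intro x; rfl
    | succ k ih => intro x; rw [pow_succ, pow_succ, mul_apply_eq_comp, mul_apply_eq_comp, ih, h]
  have h1 := (NormedSpace.exp_series_hasSum_exp' (𝕂 := ℂ) a).mapL (ContinuousLinearMap.apply ℂ V x)
  have h2 := (NormedSpace.exp_series_hasSum_exp' (𝕂 := ℂ) b).mapL
    (ContinuousLinearMap.apply ℂ W (S x))
  refine (h1.mapL S).unique ?_
  have h3 : ∀ k : ℕ, S (((k.factorial : ℂ)⁻¹ • a ^ k) x) = ((k.factorial : ℂ)⁻¹ • b ^ k) (S x) :=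
    fun k => by rw [smul_apply, smul_apply, map_smul, hpow]
  exact (funext h3) ▸ h2
theorem NormedSpace.exp_mul_exp_neg {B : Type*} [NormedRing B] [NormedAlgebra ℂ B]
    [CompleteSpace B] (x : B) : exp x * exp (-x) = 1 := by
  let _ : NormedAlgebra ℚ B := NormedAlgebra.restrictScalars ℚ ℂ _
  rw [← exp_add_of_commute (Commute.neg_right (Commute.refl x)), add_neg_cancel, exp_zero]

namespace PowerSeries

variable {n : ℕ}

/-- The coefficients of degree less than `N` of a vector of power series. -/
def vecTrunc (n N : ℕ) : (Fin n → ℂ⟦X⟧) →ₗ[ℂ] (Fin N → Fin n → ℂ) where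
  toFun v m i := coeff m (v i)
  map_add' _ _ := rfl
  map_smul' _ _ := rfl

theorem vecTrunc_apply (N : ℕ) (v : Fin n → ℂ⟦X⟧) (m : Fin N) (i : Fin n) :
    vecTrunc n N v m i = coeff m (v i) := rfl

/-- The vector of polynomials with given coefficients. -/
def vecLift (n N : ℕ) : (Fin N → Fin n → ℂ) →ₗ[ℂ] (Fin n → ℂ⟦X⟧) where
  toFun x i := mk fun m => if h : m < N then x ⟨m, h⟩ i else 0
  map_add' x y := by
    ext i m
    by_cases h : m < N <;> simp [h]
  map_smul' c x := by
    ext i m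
    by_cases h : m < N <;> simp [h]

theorem vecTrunc_vecLift (N : ℕ) (x : Fin N → Fin n → ℂ) : vecTrunc n N (vecLift n N x) = x := by
  ext m i
  simp [vecTrunc_apply, vecLift]

theorem ext_vecTrunc {v w : Fin n → ℂ⟦X⟧} (h : ∀ N, vecTrunc n N v = vecTrunc n N w) : v = w := by
  ext i m
  exact congrFun (congrFun (h (m + 1)) (Fin.last m)) i

/-- Operators that preserve the `X`-adic filtration. -/
def PreservesTrunc (T : (Fin n → ℂ⟦X⟧) →ₗ[ℂ] (Fin n → ℂ⟦X⟧)) : Prop :=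
  ∀ N v, vecTrunc n N v = 0 → vecTrunc n N (T v) = 0

/-- The operator induced on truncated series. -/
def truncOp (T : (Fin n → ℂ⟦X⟧) →ₗ[ℂ] (Fin n → ℂ⟦X⟧)) (N : ℕ) :
    (Fin N → Fin n → ℂ) →L[ℂ] (Fin N → Fin n → ℂ) :=
  LinearMap.toContinuousLinearMap (vecTrunc n N ∘ₗ T ∘ₗ vecLift n N)

theorem truncOp_vecTrunc {T : (Fin n → ℂ⟦X⟧) →ₗ[ℂ] (Fin n → ℂ⟦X⟧)} (hT : PreservesTrunc T)
    (N : ℕ) (v : Fin n → ℂ⟦X⟧) : truncOp T N (vecTrunc n N v) = vecTrunc n N (T v) := by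
  have h := hT N (vecLift n N (vecTrunc n N v) - v) (by
    rw [map_sub, vecTrunc_vecLift, sub_self])
  rw [map_sub, map_sub, sub_eq_zero] at h
  exact h

/-- The exponential of an operator that preserves the `X`-adic filtration. -/
def expOp (T : (Fin n → ℂ⟦X⟧) →ₗ[ℂ] (Fin n → ℂ⟦X⟧)) (v : Fin n → ℂ⟦X⟧) : Fin n → ℂ⟦X⟧ :=
  fun i => mk fun m =>
    NormedSpace.exp (truncOp T (m + 1)) (vecTrunc n (m + 1) v) (Fin.last m) i

/-- Truncation from level `N` to level `m + 1` intertwines the truncated operators, hence their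
exponentials, so the coefficient `m` is the same at every level above `m`. Identities for `expOp`
thereby reduce to finite-dimensional ones. -/
theorem vecTrunc_expOp {T : (Fin n → ℂ⟦X⟧) →ₗ[ℂ] (Fin n → ℂ⟦X⟧)} (hT : PreservesTrunc T)
    (N : ℕ) (v : Fin n → ℂ⟦X⟧) :
    vecTrunc n N (expOp T v) = NormedSpace.exp (truncOp T N) (vecTrunc n N v) := by
  ext ⟨m, hm⟩ i
  let r : (Fin N → Fin n → ℂ) →L[ℂ] (Fin (m + 1) → Fin n → ℂ) :=
    LinearMap.toContinuousLinearMap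
      (LinearMap.funLeft ℂ (Fin n → ℂ) (Fin.castLE (Nat.succ_le_of_lt hm)))
  have hr : ∀ v, r (vecTrunc n N v) = vecTrunc n (m + 1) v := fun v => rfl
  have h := ContinuousLinearMap.comp_exp_apply r (truncOp T N) (truncOp T (m + 1)) (fun x => by
    rw [← vecTrunc_vecLift N x, truncOp_vecTrunc hT, hr, hr, truncOp_vecTrunc hT])
    (vecTrunc n N v)
  rw [hr] at h
  have h2 : vecTrunc n N (expOp T v) ⟨m, hm⟩ i =
      NormedSpace.exp (truncOp T (m + 1)) (vecTrunc n (m + 1) v) (Fin.last m) i := by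
    rw [vecTrunc_apply, expOp, coeff_mk]
  rw [h2, ← h]
  rfl

theorem expOp_add {T : (Fin n → ℂ⟦X⟧) →ₗ[ℂ] (Fin n → ℂ⟦X⟧)} (hT : PreservesTrunc T)
    (v w : Fin n → ℂ⟦X⟧) : expOp T (v + w) = expOp T v + expOp T w :=
  ext_vecTrunc fun N => by simp only [vecTrunc_expOp hT, map_add]

theorem expOp_smul {T : (Fin n → ℂ⟦X⟧) →ₗ[ℂ] (Fin n → ℂ⟦X⟧)} (hT : PreservesTrunc T)
    (c : ℂ) (v : Fin n → ℂ⟦X⟧) : expOp T (c • v) = c • expOp T v :=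
  ext_vecTrunc fun N => by simp only [vecTrunc_expOp hT, map_smul]

theorem expOp_comp {T T' U : (Fin n → ℂ⟦X⟧) →ₗ[ℂ] (Fin n → ℂ⟦X⟧)} (hT : PreservesTrunc T)
    (hT' : PreservesTrunc T') (hU : PreservesTrunc U) (h : ∀ v, U (T v) = T' (U v))
    (v : Fin n → ℂ⟦X⟧) : U (expOp T v) = expOp T' (U v) :=
  ext_vecTrunc fun N => by
    rw [vecTrunc_expOp hT', ← truncOp_vecTrunc hU, ← truncOp_vecTrunc hU, vecTrunc_expOp hT]
    refine ContinuousLinearMap.comp_exp_apply _ _ _ (fun x => ?_) _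
    rw [← vecTrunc_vecLift N x, truncOp_vecTrunc hT, truncOp_vecTrunc hU, truncOp_vecTrunc hU,
      truncOp_vecTrunc hT', h]

theorem expOp_expOp_neg {T : (Fin n → ℂ⟦X⟧) →ₗ[ℂ] (Fin n → ℂ⟦X⟧)} (hT : PreservesTrunc T)
    (hT' : PreservesTrunc (-T)) (v : Fin n → ℂ⟦X⟧) : expOp T (expOp (-T) v) = v :=
  ext_vecTrunc fun N => by
    have h : truncOp (-T) N = -truncOp T N := by
      ext x : 1
      simp [truncOp]
    rw [vecTrunc_expOp hT, vecTrunc_expOp hT', h]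
    exact DFunLike.congr_fun (NormedSpace.exp_mul_exp_neg (truncOp T N)) _

theorem expOp_add_const {T : (Fin n → ℂ⟦X⟧) →ₗ[ℂ] (Fin n → ℂ⟦X⟧)} (hT : PreservesTrunc T) (c : ℂ)
    (hT' : PreservesTrunc (T + c • LinearMap.id)) (v : Fin n → ℂ⟦X⟧) :
    expOp (T + c • LinearMap.id) v = Complex.exp c • expOp T v :=
  ext_vecTrunc fun N => by
    have h : truncOp (T + c • LinearMap.id) N =
        algebraMap ℂ ((Fin N → Fin n → ℂ) →L[ℂ] (Fin N → Fin n → ℂ)) c + truncOp T N := by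
      ext x : 1
      simp [truncOp, vecTrunc_vecLift, add_comm, Algebra.algebraMap_eq_smul_one]
    let _ : NormedAlgebra ℚ ((Fin N → Fin n → ℂ) →L[ℂ] (Fin N → Fin n → ℂ)) :=
      NormedAlgebra.restrictScalars ℚ ℂ _
    rw [vecTrunc_expOp hT', h, NormedSpace.exp_add_of_commute (Algebra.commutes _ _),
      ← NormedSpace.algebraMap_exp_comm, map_smul, vecTrunc_expOp hT, ← Complex.exp_eq_exp_ℂ,
      Algebra.algebraMap_eq_smul_one]
    rfl

end PowerSeries

/-! ### The flow `exp (c θ)` on a lattice of a regular connection. -/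

namespace PowerSeries

variable {n : ℕ}

theorem vecTrunc_eq_zero_iff (N : ℕ) (v : Fin n → ℂ⟦X⟧) :
    vecTrunc n N v = 0 ↔ ∀ i, X ^ N ∣ v i := by
  simp only [X_pow_dvd_iff, funext_iff, vecTrunc_apply, Pi.zero_apply]
  exact ⟨fun h i m hm => h ⟨m, hm⟩ i, fun h m i => h i m m.2⟩

theorem coeff_X_mul_derivative (f : ℂ⟦X⟧) (m : ℕ) :
    coeff m (X * derivative ℂ f) = m * coeff m f := by
  cases m with
  | zero => simp
  | succ m =>
    rw [coeff_succ_X_mul, coeff_derivative, mul_comm]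
    push_cast
    rfl

/-- The operator `u ∂_u` in the lattice `ℂ[[u]]ⁿ` with matrix `A`. -/
def connOp (A : Matrix (Fin n) (Fin n) ℂ⟦X⟧) : (Fin n → ℂ⟦X⟧) →ₗ[ℂ] (Fin n → ℂ⟦X⟧) where
  toFun v i := X * derivative ℂ (v i) + ∑ j, A i j * v j
  map_add' v w := by
    ext1 i
    simp only [Pi.add_apply, map_add, mul_add, Finset.sum_add_distrib]
    abel
  map_smul' c v := by
    ext1 i
    simp only [Pi.smul_apply, Derivation.map_smul, RingHom.id_apply, mul_smul_comm, smul_add,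
      Finset.smul_sum]

theorem connOp_apply (A : Matrix (Fin n) (Fin n) ℂ⟦X⟧) (v : Fin n → ℂ⟦X⟧) (i : Fin n) :
    connOp A v i = X * derivative ℂ (v i) + ∑ j, A i j * v j := rfl

theorem preservesTrunc_connOp (A : Matrix (Fin n) (Fin n) ℂ⟦X⟧) : PreservesTrunc (connOp A) := by
  intro N v hv
  rw [vecTrunc_eq_zero_iff] at hv ⊢
  intro i
  rw [connOp_apply]
  refine dvd_add ?_ (Finset.dvd_sum fun j _ => (hv j).mul_left _)
  rw [X_pow_dvd_iff]
  intro m hm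
  rw [coeff_X_mul_derivative, X_pow_dvd_iff.mp (hv i) m hm, mul_zero]

theorem PreservesTrunc.smul {T : (Fin n → ℂ⟦X⟧) →ₗ[ℂ] (Fin n → ℂ⟦X⟧)} (hT : PreservesTrunc T)
    (c : ℂ) : PreservesTrunc (c • T) := fun N v hv => by
  rw [LinearMap.smul_apply, map_smul, hT N v hv, smul_zero]

theorem PreservesTrunc.add {T U : (Fin n → ℂ⟦X⟧) →ₗ[ℂ] (Fin n → ℂ⟦X⟧)} (hT : PreservesTrunc T)
    (hU : PreservesTrunc U) : PreservesTrunc (T + U) := fun N v hv => by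
  rw [LinearMap.add_apply, map_add, hT N v hv, hU N v hv, add_zero]

theorem preservesTrunc_id :
    PreservesTrunc (LinearMap.id : (Fin n → ℂ⟦X⟧) →ₗ[ℂ] (Fin n → ℂ⟦X⟧)) := fun _ _ hv => hv

/-- Multiplication by `X`. -/
def mulX (n : ℕ) : (Fin n → ℂ⟦X⟧) →ₗ[ℂ] (Fin n → ℂ⟦X⟧) where
  toFun v := (X : ℂ⟦X⟧) • v
  map_add' _ _ := smul_add _ _ _
  map_smul' _ _ := smul_comm _ _ _

theorem preservesTrunc_mulX : PreservesTrunc (mulX n) := by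
  intro N v hv
  rw [vecTrunc_eq_zero_iff] at hv ⊢
  exact fun i => (hv i).mul_left _

theorem connOp_X_smul (A : Matrix (Fin n) (Fin n) ℂ⟦X⟧) (v : Fin n → ℂ⟦X⟧) :
    connOp A ((X : ℂ⟦X⟧) • v) = (X : ℂ⟦X⟧) • (connOp A v + v) := by
  ext1 i
  simp only [connOp_apply, Pi.smul_apply, Pi.add_apply, smul_eq_mul, Derivation.leibniz,
    derivative_X, mul_add, Finset.mul_sum]
  have : ∀ j, A i j * (X * v j) = X * (A i j * v j) := fun j => by ring
  simp only [this]
  ring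

/-- The operator `exp (c u ∂_u)`. -/
def monodromyOp (A : Matrix (Fin n) (Fin n) ℂ⟦X⟧) (c : ℂ) (v : Fin n → ℂ⟦X⟧) : Fin n → ℂ⟦X⟧ :=
  expOp (c • connOp A) v

theorem monodromyOp_add (A : Matrix (Fin n) (Fin n) ℂ⟦X⟧) (c : ℂ) (v w : Fin n → ℂ⟦X⟧) :
    monodromyOp A c (v + w) = monodromyOp A c v + monodromyOp A c w :=
  expOp_add ((preservesTrunc_connOp A).smul c) v w

theorem monodromyOp_const_smul (A : Matrix (Fin n) (Fin n) ℂ⟦X⟧) (c a : ℂ) (v : Fin n → ℂ⟦X⟧) :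
    monodromyOp A c (a • v) = a • monodromyOp A c v :=
  expOp_smul ((preservesTrunc_connOp A).smul c) a v

theorem monodromyOp_monodromyOp_neg (A : Matrix (Fin n) (Fin n) ℂ⟦X⟧) (c : ℂ)
    (v : Fin n → ℂ⟦X⟧) : monodromyOp A c (monodromyOp A (-c) v) = v := by
  have h := (preservesTrunc_connOp A).smul c
  have h' := (preservesTrunc_connOp A).smul (-c)
  have hneg : (-c) • connOp A = -(c • connOp A) := by
    refine LinearMap.ext fun w => ?_
    simp only [LinearMap.smul_apply, LinearMap.neg_apply, neg_smul]
  simp only [monodromyOp]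
  rw [hneg] at h' ⊢
  exact expOp_expOp_neg h h' v

theorem connOp_monodromyOp (A : Matrix (Fin n) (Fin n) ℂ⟦X⟧) (c : ℂ) (v : Fin n → ℂ⟦X⟧) :
    connOp A (monodromyOp A c v) = monodromyOp A c (connOp A v) := by
  have h := (preservesTrunc_connOp A).smul c
  exact expOp_comp h h (preservesTrunc_connOp A) (fun v => by simp) v

/-- Since `θ ∘ X = X ∘ (θ + 1)`, multiplication by `X` intertwines `c θ + c` with `c θ`;
exponentiating, the constant `c` contributes the factor `e^c`. -/
theorem monodromyOp_X_smul (A : Matrix (Fin n) (Fin n) ℂ⟦X⟧) (c : ℂ) (v : Fin n → ℂ⟦X⟧) :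
    monodromyOp A c ((X : ℂ⟦X⟧) • v) =
      (Complex.exp c) • (X : ℂ⟦X⟧) • monodromyOp A c v := by
  have h := (preservesTrunc_connOp A).smul c
  have h' := h.add (preservesTrunc_id.smul c)
  have h1 := expOp_comp h' h preservesTrunc_mulX (fun v => by
    change (X : ℂ⟦X⟧) • (c • connOp A v + c • v) = c • connOp A ((X : ℂ⟦X⟧) • v)
    rw [connOp_X_smul, ← smul_add, smul_comm]) v
  rw [expOp_add_const h c h', map_smul] at h1
  exact h1.symm

/-- The rule holds for constants and for `X`. Peeling off `f = X g + a` repeatedly gives it modulo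
`X ^ N` for every `N`, which suffices. -/
theorem monodromyOp_smul (A : Matrix (Fin n) (Fin n) ℂ⟦X⟧) (c : ℂ) (f : ℂ⟦X⟧)
    (v : Fin n → ℂ⟦X⟧) :
    monodromyOp A c (f • v) = rescale (Complex.exp c) f • monodromyOp A c v := by
  suffices H : ∀ (N : ℕ) (f : ℂ⟦X⟧), ∃ w : Fin n → ℂ⟦X⟧,
      monodromyOp A c (f • v) = rescale (Complex.exp c) f • monodromyOp A c v +
        ((X : ℂ⟦X⟧) ^ N) • w by
    refine ext_vecTrunc fun N => ?_
    obtain ⟨w, hw⟩ := H N f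
    have h : vecTrunc n N ((X : ℂ⟦X⟧) ^ N • w) = 0 :=
      (vecTrunc_eq_zero_iff N _).mpr fun i => dvd_mul_right _ _
    rw [hw, map_add, h, add_zero]
  intro N
  induction N with
  | zero =>
    intro f
    exact ⟨monodromyOp A c (f • v) - rescale (Complex.exp c) f • monodromyOp A c v, by simp⟩
  | succ N ih =>
    intro f
    obtain ⟨g, a, hf⟩ : ∃ (g : ℂ⟦X⟧) (a : ℂ), f = X * g + C a :=
      ⟨_, _, eq_X_mul_shift_add_const f⟩
    obtain ⟨w, hw⟩ := ih g
    refine ⟨Complex.exp c • w, ?_⟩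
    have hC : ∀ x : Fin n → ℂ⟦X⟧, C a • x = a • x := fun x => by
      ext1 i
      simp [smul_eq_C_mul]
    have hr : rescale (Complex.exp c) (C a) = C a := by
      ext m
      rw [coeff_rescale, coeff_C]
      split_ifs with h
      · rw [h, pow_zero, one_mul]
      · rw [mul_zero]
    rw [hf, add_smul, monodromyOp_add, mul_smul, monodromyOp_X_smul, hw, hC,
      monodromyOp_const_smul, map_add, map_mul, rescale_X, hr]
    ext1 i
    simp [smul_eq_C_mul]
    ring

end PowerSeries

namespace FormalConn

theorem compMuHom_coe (ζ : ℂˣ) (f : ℂ⟦X⟧) :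
    compMuHom ζ (f : ℂ⸨X⸩) = ((PowerSeries.rescale (ζ : ℂ) f : ℂ⟦X⟧) : ℂ⸨X⸩) := by
  ext n
  rw [compMuHom_apply, compMu_coeff, PowerSeries.coeff_coe, PowerSeries.coeff_coe]
  split_ifs with hn
  · rw [mul_zero]
  · obtain ⟨m, rfl⟩ := Int.eq_ofNat_of_zero_le (not_lt.mp hn)
    simp

end FormalConn

/-! ### Regular connections are isomorphic to their pullbacks by `u ↦ ζ u`. -/

namespace ConnSpace

/-- The operator `u ∂_u`. -/
def theta (M : ConnSpace.{u}) : M →+ M :=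
  (DistribSMul.toAddMonoidHom M (HahnSeries.single (1 : ℤ) (1 : ℂ) : ℂ⸨X⸩)).comp M.del

theorem theta_apply (M : ConnSpace.{u}) (m : M) :
    M.theta m = (HahnSeries.single (1 : ℤ) (1 : ℂ) : ℂ⸨X⸩) • M.del m := rfl

theorem theta_smul (M : ConnSpace.{u}) (f : ℂ⸨X⸩) (m : M) :
    M.theta (f • m) = FormalConn.theta f • m + f • M.theta m := by
  simp only [theta_apply, M.leibniz, smul_add, smul_smul, FormalConn.theta]
  rw [mul_comm f]

section Lattice

variable {M : ConnSpace.{u}} {n : ℕ} (b : Module.Basis (Fin n) ℂ⸨X⸩ M)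

/-- The vector with given coordinates in `ℂ[[u]]`. -/
def ofCoords (v : Fin n → ℂ⟦X⟧) : M := ∑ i, ((v i : ℂ⟦X⟧) : ℂ⸨X⸩) • b i

theorem ofCoords_add (v w : Fin n → ℂ⟦X⟧) :
    ofCoords b (v + w) = ofCoords b v + ofCoords b w := by
  simp only [ofCoords, Pi.add_apply, PowerSeries.coe_add, add_smul, Finset.sum_add_distrib]

theorem ofCoords_smul (f : ℂ⟦X⟧) (v : Fin n → ℂ⟦X⟧) :
    ofCoords b (f • v) = (f : ℂ⸨X⸩) • ofCoords b v := by
  simp only [ofCoords, Pi.smul_apply, smul_eq_mul, PowerSeries.coe_mul, mul_smul, Finset.smul_sum]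

theorem ofCoords_single (j : Fin n) : ofCoords b (Pi.single j 1) = b j := by
  rw [ofCoords, Finset.sum_eq_single j]
  · simp
  · intro i _ hi
    simp [hi]
  · simp

theorem theta_ofCoords (A : Matrix (Fin n) (Fin n) ℂ⟦X⟧)
    (hA : ∀ j, M.theta (b j) = ∑ i, ((A i j : ℂ⟦X⟧) : ℂ⸨X⸩) • b i) (v : Fin n → ℂ⟦X⟧) :
    M.theta (ofCoords b v) = ofCoords b (PowerSeries.connOp A v) := by
  simp only [ofCoords, map_sum, theta_smul, hA, FormalConn.theta_coe, PowerSeries.connOp_apply,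
    Finset.sum_add_distrib, PowerSeries.coe_add, add_smul]
  congr 1
  simp only [Finset.smul_sum, smul_smul]
  rw [Finset.sum_comm]
  refine Finset.sum_congr rfl fun i _ => ?_
  rw [← Finset.sum_smul]
  congr 1
  refine Finset.sum_congr rfl fun j _ => ?_
  rw [map_mul, mul_comm]

/-- The `μ_ζ`-semilinear map that sends `b j` to `w j`. -/
def semilinearMap (ζ : ℂˣ) (w : Fin n → M) : M →+ M where
  toFun m := ∑ j, compMuHom ζ (b.repr m j) • w j
  map_zero' := Finset.sum_eq_zero fun j _ => by
    rw [map_zero, Finsupp.zero_apply, map_zero]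
    exact zero_smul ℂ⸨X⸩ (w j)
  map_add' m m' := by
    simp only [map_add, Finsupp.add_apply, add_smul, Finset.sum_add_distrib]

theorem semilinearMap_apply (ζ : ℂˣ) (w : Fin n → M) (m : M) :
    semilinearMap b ζ w m = ∑ j, compMuHom ζ (b.repr m j) • w j := rfl

theorem semilinearMap_smul (ζ : ℂˣ) (w : Fin n → M) (f : ℂ⸨X⸩) (m : M) :
    semilinearMap b ζ w (f • m) = compMuHom ζ f • semilinearMap b ζ w m := by
  simp only [semilinearMap_apply, map_smul, Finsupp.smul_apply, smul_eq_mul, map_mul, mul_smul,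
    Finset.smul_sum]

theorem semilinearMap_basis (ζ : ℂˣ) (w : Fin n → M) (j : Fin n) :
    semilinearMap b ζ w (b j) = w j := by
  rw [semilinearMap_apply, Finset.sum_eq_single j]
  · simp
  · intro i _ hi
    simp [hi.symm]
  · simp

theorem basis_induction {P : M → Prop} (h0 : P 0) (hadd : ∀ x y, P x → P y → P (x + y))
    (hsmul : ∀ (f : ℂ⸨X⸩) j, P (f • b j)) (m : M) : P m := by
  rw [← b.sum_repr m]
  exact Finset.sum_induction _ P hadd h0 fun j _ => hsmul _ j

end Lattice

/-- The map is `exp (c θ)` for `c = log ζ`, defined on the lattice spanned by a regular basis and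
extended semilinearly to `M`; the flow for `-c` inverts it. -/
theorem exists_monodromy (M : ConnSpace.{u}) (hM : M.IsRegular) (ζ : ℂˣ) :
    ∃ σ : M ≃+ M, (∀ (f : ℂ⸨X⸩) m, σ (f • m) = compMuHom ζ f • σ m) ∧
      ∀ m, σ (M.theta m) = M.theta (σ m) := by
  obtain ⟨n, b, A, hA⟩ := hM
  have hA' : ∀ j, M.theta (b j) = ∑ i, ((A i j : ℂ⟦X⟧) : ℂ⸨X⸩) • b i := hA
  let s : (ζ : ℂˣ) → (c : ℂ) → M →+ M := fun ζ c =>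
    semilinearMap b ζ fun j => ofCoords b (PowerSeries.monodromyOp A c (Pi.single j 1))
  -- The extension is defined by its values on the basis; semilinearity of the flow makes the two
  -- agree on the whole lattice.
  have hs1 : ∀ (ζ : ℂˣ) c, Complex.exp c = ζ → ∀ v,
      s ζ c (ofCoords b v) = ofCoords b (PowerSeries.monodromyOp A c v) := by
    intro ζ c hc v
    have h1 : ∀ j (f : ℂ⟦X⟧), s ζ c (ofCoords b (f • Pi.single j 1)) =
        ofCoords b (PowerSeries.monodromyOp A c (f • Pi.single j 1)) := fun j f => by
      rw [ofCoords_smul, semilinearMap_smul, ofCoords_single, semilinearMap_basis,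
        PowerSeries.monodromyOp_smul, ofCoords_smul, compMuHom_coe, hc]
    have h2 : v = ∑ j, v j • (Pi.single j 1 : Fin n → ℂ⟦X⟧) := by
      ext1 i
      simp [Pi.single_apply]
    have h0 : ofCoords b 0 = 0 := by simp [ofCoords]
    rw [h2]
    refine Finset.sum_induction _ (fun v => s ζ c (ofCoords b v) =
      ofCoords b (PowerSeries.monodromyOp A c v)) (fun x y hx hy => ?_) ?_ fun j _ => h1 j _
    · rw [ofCoords_add, map_add, hx, hy, PowerSeries.monodromyOp_add, ofCoords_add]
    · have := PowerSeries.monodromyOp_const_smul A c 0 0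
      rw [zero_smul, zero_smul] at this
      rw [this, h0, map_zero]
  have hs2 : ∀ (ζ η : ℂˣ) c, Complex.exp c = ζ → ζ * η = 1 → ∀ m, s ζ c (s η (-c) m) = m := by
    intro ζ η c hc hη m
    induction m using basis_induction b with
    | h0 => rw [map_zero, map_zero]
    | hadd x y hx hy => rw [map_add, map_add, hx, hy]
    | hsmul f j =>
      rw [semilinearMap_smul, semilinearMap_smul, compMuHom_compMuHom, hη, compMuHom_one,
        semilinearMap_basis, hs1 ζ c hc, PowerSeries.monodromyOp_monodromyOp_neg, ofCoords_single]
  have hexp : Complex.exp (Complex.log ζ) = ζ := Complex.exp_log ζ.ne_zero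
  have hexp' : Complex.exp (-Complex.log ζ) = (ζ⁻¹ : ℂˣ) := by
    rw [Complex.exp_neg, hexp, Units.val_inv_eq_inv_val]
  refine ⟨{ s ζ (Complex.log ζ) with
    invFun := s ζ⁻¹ (-Complex.log ζ)
    left_inv := fun m => ?_
    right_inv := hs2 ζ ζ⁻¹ _ hexp (mul_inv_cancel ζ) }, semilinearMap_smul b ζ _, fun m => ?_⟩
  · have := hs2 ζ⁻¹ ζ _ hexp' (inv_mul_cancel ζ) m
    rwa [neg_neg] at this
  · change s ζ (Complex.log ζ) (M.theta m) = M.theta (s ζ (Complex.log ζ) m)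
    induction m using basis_induction b with
    | h0 => simp only [map_zero]
    | hadd x y hx hy => simp only [map_add, hx, hy]
    | hsmul f j =>
      rw [theta_smul, map_add, semilinearMap_smul, semilinearMap_smul, semilinearMap_smul,
        theta_smul, theta_compMuHom]
      congr 2
      rw [← ofCoords_single b j, theta_ofCoords b A hA', hs1 ζ _ hexp, hs1 ζ _ hexp,
        theta_ofCoords b A hA', PowerSeries.connOp_monodromyOp]

end ConnSpace

/-! ### Vanishing of morphisms between twists that differ by a pole. -/

namespace FormalConn

theorem coeff_coe_mul_eq_zero (f : ℂ⟦X⟧) {x : ℂ⸨X⸩} {N : ℤ} (hx : ∀ m < N, x.coeff m = 0) :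
    ∀ m < N, ((f : ℂ⸨X⸩) * x).coeff m = 0 := by
  intro m hm
  rw [HahnSeries.coeff_mul]
  refine Finset.sum_eq_zero fun ij hij => ?_
  have h := (Finset.mem_antidiagonal.mp hij).2.2
  rcases lt_or_ge ij.1 0 with h1 | h1
  · rw [PowerSeries.coeff_coe, if_pos h1, zero_mul]
  · rw [hx _ (by omega), mul_zero]

end FormalConn

namespace ConnSpace

/-- There are no nonzero morphisms between `𝓔^φ ⊗ M` and `𝓔^ψ ⊗ N` when `M` and `N` are regular
and `ψ - φ = h` has a pole. -/
theorem eq_zero_of_pole {M : ConnSpace.{u}} {N : ConnSpace.{v}} (hM : M.IsRegular)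
    (hN : N.IsRegular) (h : ℂ⸨X⸩) (hh : h ∉ Set.range ((↑) : ℂ⟦X⟧ → ℂ⸨X⸩)) (F : M →ₗ[ℂ⸨X⸩] N)
    (hF : ∀ m, F (M.theta m) = N.theta (F m) + FormalConn.theta h • F m) : F = 0 := by
  obtain ⟨n, b, A, hA⟩ := hM
  obtain ⟨k, c, B, hB⟩ := hN
  have hA' : ∀ j, M.theta (b j) = ∑ i, ((A i j : ℂ⟦X⟧) : ℂ⸨X⸩) • b i := hA
  have hB' : ∀ j, N.theta (c j) = ∑ i, ((B i j : ℂ⟦X⟧) : ℂ⸨X⸩) • c i := hB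
  let P : Fin k → Fin n → ℂ⸨X⸩ := fun i j => c.repr (F (b j)) i
  have hFb : ∀ j, F (b j) = ∑ i, P i j • c i := fun j => (c.sum_repr (F (b j))).symm
  have hrepr : ∀ (x : Fin k → ℂ⸨X⸩) i, c.repr (∑ i, x i • c i) i = x i := fun x i => by
    rw [← c.equivFun_symm_apply, ← c.equivFun_apply, LinearEquiv.apply_symm_apply]
  -- The intertwining relation for the matrix `P` of `F`: `θ(h) P = P A - (θ(P) + B P)`.
  have key : ∀ i j, FormalConn.theta h * P i j =
      ∑ l, ((A l j : ℂ⟦X⟧) : ℂ⸨X⸩) * P i l - (FormalConn.theta (P i j) +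
        ∑ l, ((B i l : ℂ⟦X⟧) : ℂ⸨X⸩) * P l j) := by
    intro i j
    have h1 := congrArg (fun m => c.repr m i) (hF (b j))
    have h2 : N.theta (F (b j)) = ∑ i, (FormalConn.theta (P i j) +
        ∑ l, ((B i l : ℂ⟦X⟧) : ℂ⸨X⸩) * P l j) • c i := by
      rw [hFb, map_sum]
      simp only [theta_smul, hB', add_smul, Finset.sum_add_distrib, Finset.smul_sum,
        Finset.sum_smul, smul_smul]
      rw [Finset.sum_comm]
      simp only [mul_comm]
    have h3 : c.repr (F (M.theta (b j))) i = ∑ l, ((A l j : ℂ⟦X⟧) : ℂ⸨X⸩) * P i l := by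
      simp only [hA', map_sum, map_smul, Finsupp.finsetSum_apply, Finsupp.smul_apply, smul_eq_mul,
        P]
    have h4 : c.repr (N.theta (F (b j)) + FormalConn.theta h • F (b j)) i =
        (FormalConn.theta (P i j) + ∑ l, ((B i l : ℂ⟦X⟧) : ℂ⸨X⸩) * P l j) +
          FormalConn.theta h * P i j := by
      rw [map_add, Finsupp.add_apply, h2, hrepr, map_smul, Finsupp.smul_apply, smul_eq_mul]
    rw [eq_sub_iff_add_eq', ← h3, ← h4]
    exact h1.symm
  classical
  by_contra hF0
  have hP : ∃ q : Fin k × Fin n, P q.1 q.2 ≠ 0 := by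
    by_contra! hP
    exact hF0 (b.ext fun j => by
      rw [hFb, LinearMap.zero_apply]
      exact Finset.sum_eq_zero fun i _ => by rw [hP (i, j)]; exact zero_smul ℂ⸨X⸩ (c i))
  -- Take an entry of least order. As `A` and `B` have no poles and `θ` does not lower orders, the
  -- right side of `key` has order at least `ord (P i j)`, whereas the left side has order `ord θ(h)
  -- + ord (P i j)`, which is smaller.
  obtain ⟨⟨i, j⟩, hq, hmin⟩ := Finset.exists_min_image
    (Finset.univ.filter fun q : Fin k × Fin n => P q.1 q.2 ≠ 0) (fun q => (P q.1 q.2).order)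
    (hP.imp fun q hq => by simpa using hq)
  have hij : P i j ≠ 0 := by simpa using hq
  have hlow : ∀ i' j', ∀ m < (P i j).order, (P i' j').coeff m = 0 := by
    intro i' j' m hm
    by_cases h0 : P i' j' = 0
    · rw [h0, HahnSeries.coeff_zero]
    · exact HahnSeries.coeff_eq_zero_of_lt_order (hm.trans_le (hmin (i', j') (by simpa using h0)))
  have hpole : ∃ m < 0, h.coeff m ≠ 0 := by
    rw [mem_range_coe_iff] at hh
    push Not at hh
    exact hh
  obtain ⟨m, hm, hhm⟩ := hpole
  have htm : (FormalConn.theta h).coeff m ≠ 0 := by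
    rw [coeff_theta]
    exact mul_ne_zero (by exact_mod_cast hm.ne) hhm
  have hto : (FormalConn.theta h).order < 0 :=
    (HahnSeries.order_le_of_coeff_ne_zero htm).trans_lt hm
  have ht0 : FormalConn.theta h ≠ 0 := fun h0 => htm (by rw [h0, HahnSeries.coeff_zero])
  have hlt : (FormalConn.theta h).order + (P i j).order < (P i j).order := by omega
  have h1 := congrArg (fun x => x.coeff ((FormalConn.theta h).order + (P i j).order)) (key i j)
  simp only [HahnSeries.coeff_sub, HahnSeries.coeff_add, HahnSeries.coeff_sum] at h1
  rw [HahnSeries.coeff_mul_order_add_order, Finset.sum_eq_zero fun l _ =>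
      coeff_coe_mul_eq_zero _ (hlow i l) _ hlt, Finset.sum_eq_zero fun l _ =>
      coeff_coe_mul_eq_zero _ (hlow l j) _ hlt, coeff_theta, hlow i j _ hlt] at h1
  simp [ht0, hij] at h1

end ConnSpace

/-! ### Elementary connections described on the underlying spaces `M` and `N`. -/

namespace ConnSpace

/-- The operator of `𝓔^φ ⊗ M` in the direction `u ∂_u`, on the space `M`. -/
def twistTheta (M : ConnSpace.{u}) (φ : ℂ⸨X⸩) (m : M) : M :=
  M.theta m + FormalConn.theta φ • m

theorem twistTheta_add (M : ConnSpace.{u}) (φ : ℂ⸨X⸩) (m m' : M) :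
    M.twistTheta φ (m + m') = M.twistTheta φ m + M.twistTheta φ m' := by
  simp only [twistTheta, map_add, smul_add]
  abel

theorem twistTheta_smul (M : ConnSpace.{u}) (φ f : ℂ⸨X⸩) (m : M) :
    M.twistTheta φ (f • m) = FormalConn.theta f • m + f • M.twistTheta φ m := by
  simp only [twistTheta, theta_smul, smul_add, smul_smul, mul_comm f]
  abel

/-- An isomorphism of the push-forwards of `𝓔^φ ⊗ M` and `𝓔^ψ ⊗ N` by `u ↦ u ^ p`, on the
underlying spaces `M` and `N`. -/
def TwistIso (p : ℕ) [NeZero p] (φ : ℂ⸨X⸩) (M : ConnSpace.{u}) (ψ : ℂ⸨X⸩) (N : ConnSpace.{v}) :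
    Prop :=
  ∃ e : M ≃+ N, (∀ (f : ℂ⸨X⸩) m, e (ramify p f • m) = ramify p f • e m) ∧
    ∀ m, e (M.twistTheta φ m) = N.twistTheta ψ (e m)

variable {p : ℕ} [NeZero p] {φ ψ χ : ℂ⸨X⸩} {M : ConnSpace.{u}} {N : ConnSpace.{v}}
  {Q : ConnSpace.{w}}

theorem TwistIso.symm : TwistIso p φ M ψ N → TwistIso p ψ N φ M := by
  rintro ⟨e, h1, h2⟩
  refine ⟨e.symm, fun f m => ?_, fun m => ?_⟩
  · rw [AddEquiv.symm_apply_eq, h1, e.apply_symm_apply]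
  · rw [AddEquiv.symm_apply_eq, h2, e.apply_symm_apply]

theorem TwistIso.trans : TwistIso p φ M ψ N → TwistIso p ψ N χ Q → TwistIso p φ M χ Q := by
  rintro ⟨e, h1, h2⟩ ⟨e', h1', h2'⟩
  refine ⟨e.trans e', fun f m => ?_, fun m => ?_⟩
  · simp only [AddEquiv.trans_apply, h1, h1']
  · simp only [AddEquiv.trans_apply, h2, h2']

theorem Isomorphic.twistIso (p : ℕ) [NeZero p] (φ : ℂ⸨X⸩) :
    M.Isomorphic N → TwistIso p φ M φ N := by
  rintro ⟨e, he⟩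
  refine ⟨e.toAddEquiv, fun f m => map_smul e _ m, fun m => ?_⟩
  change e (M.twistTheta φ m) = N.twistTheta φ (e m)
  simp only [twistTheta, theta_apply, map_add, map_smul, he]

/-- `𝓔^φ ⊗ M` with underlying space `M`. -/
def tensorEquiv (φ : ℂ⸨X⸩) (M : ConnSpace.{u}) : tensor (expTwist φ) M ≃ₗ[ℂ⸨X⸩] M :=
  TensorProduct.lid ℂ⸨X⸩ M

theorem tensorEquiv_theta (φ : ℂ⸨X⸩) (M : ConnSpace.{u}) (x : tensor (expTwist φ) M) :
    tensorEquiv φ M ((tensor (expTwist φ) M).theta x) = M.twistTheta φ (tensorEquiv φ M x) := by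
  let F : tensor (expTwist φ) M →+ M :=
    (tensorEquiv φ M).toLinearMap.toAddMonoidHom.comp (tensor (expTwist φ) M).theta
  let G : tensor (expTwist φ) M →+ M :=
    (AddMonoidHom.mk' (M.twistTheta φ) (M.twistTheta_add φ)).comp
      (tensorEquiv φ M).toLinearMap.toAddMonoidHom
  change F x = G x
  refine TensorProduct.induction_on (motive := fun y => F y = G y) x
    ((map_zero F).trans (map_zero G).symm) (fun f m => ?_) fun y z hy hz =>
      (map_add F y z).trans ((congrArg₂ _ hy hz).trans (map_add G y z).symm)
  let f' : ℂ⸨X⸩ := f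
  have h1 : F (f ⊗ₜ m : expTwist φ ⊗[ℂ⸨X⸩] M) = (HahnSeries.single (1 : ℤ) (1 : ℂ) : ℂ⸨X⸩) •
      tensorEquiv φ M ((expTwist φ).del f ⊗ₜ m + f ⊗ₜ M.del m : expTwist φ ⊗[ℂ⸨X⸩] M) :=
    map_smul (tensorEquiv φ M) (HahnSeries.single (1 : ℤ) (1 : ℂ) : ℂ⸨X⸩)
      ((tensor (expTwist φ) M).del (f ⊗ₜ m : expTwist φ ⊗[ℂ⸨X⸩] M))
  have h2 : tensorEquiv φ M ((expTwist φ).del f ⊗ₜ m + f ⊗ₜ M.del m : expTwist φ ⊗[ℂ⸨X⸩] M) =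
      (D f' + D φ * f') • m + f' • M.del m :=
    map_add (tensorEquiv φ M) _ _
  have h3 : G (f ⊗ₜ m : expTwist φ ⊗[ℂ⸨X⸩] M) = M.twistTheta φ (f' • m) := rfl
  refine (h1.trans (congrArg _ h2)).trans (Eq.trans ?_ h3.symm)
  rw [twistTheta, theta_apply, M.leibniz, FormalConn.theta]
  simp only [smul_add, add_smul, smul_smul]
  rw [mul_assoc]
  abel

/-- This is `u = p t / (p u^(p-1))`, that is, `u ∂_u = p t ∂_t`: commuting with `∂_t` and commuting
with `u ∂_u` are equivalent for `ℂ((t))`-linear maps. -/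
theorem single_eq_mul_inv_rhoDeriv (p : ℕ) [NeZero p] :
    (HahnSeries.single (1 : ℤ) (1 : ℂ) : ℂ⸨X⸩) =
      ramify p (HahnSeries.single 1 (p : ℂ)) * (rhoDeriv p)⁻¹ := by
  rw [eq_mul_inv_iff_mul_eq₀ (rhoDeriv_ne_zero p), rhoDeriv, HahnSeries.single_mul_single]
  ext n
  by_cases h : (p : ℤ) ∣ n
  · obtain ⟨m, rfl⟩ := h
    have hp : (p : ℤ) ≠ 0 := by exact_mod_cast NeZero.ne p
    rw [ramify_coeff_mul]
    by_cases hm : m = 1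
    · simp [hm]
    · rw [HahnSeries.coeff_single_of_ne hm, HahnSeries.coeff_single_of_ne]
      intro h
      apply hm
      apply mul_left_cancel₀ hp
      linarith
  · rw [ramify_coeff_of_not_dvd p _ n h, HahnSeries.coeff_single_of_ne]
    rintro rfl
    exact h ⟨1, by ring⟩

theorem isomorphic_pushForward_iff : (pushForward p M).Isomorphic (pushForward p N) ↔
    ∃ e : M ≃+ N, (∀ (f : ℂ⸨X⸩) m, e (ramify p f • m) = ramify p f • e m) ∧
      ∀ m, e (M.theta m) = N.theta (e m) := by
  have hτ : ramify p (HahnSeries.single 1 (p : ℂ)) ≠ 0 := fun h => by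
    have h1 := single_eq_mul_inv_rhoDeriv p
    rw [h, zero_mul] at h1
    simp at h1
  constructor
  · rintro ⟨e, he⟩
    let e' : M ≃+ N := e.toAddEquiv
    have hsmul : ∀ (f : ℂ⸨X⸩) (m : M), e' (ramify p f • m) = ramify p f • e' m :=
      fun f x => e.map_smul' f x
    have hdel : ∀ m : M, e' ((rhoDeriv p)⁻¹ • M.del m) = (rhoDeriv p)⁻¹ • N.del (e' m) := he
    refine ⟨e', hsmul, fun m => ?_⟩
    rw [theta_apply, theta_apply, single_eq_mul_inv_rhoDeriv p, mul_smul, mul_smul, hsmul, hdel]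
  · rintro ⟨e, h1, h2⟩
    have hdel : ∀ m : M, e ((rhoDeriv p)⁻¹ • M.del m) = (rhoDeriv p)⁻¹ • N.del (e m) := fun m => by
      have h3 := h2 m
      rw [theta_apply, theta_apply, single_eq_mul_inv_rhoDeriv p, mul_smul, mul_smul, h1] at h3
      exact smul_right_injective N hτ h3
    exact ⟨{ e with map_smul' := h1 }, hdel⟩

theorem isomorphic_El_iff : (El p φ M).Isomorphic (El p ψ N) ↔ TwistIso p φ M ψ N := by
  refine isomorphic_pushForward_iff.trans ⟨?_, ?_⟩
  · rintro ⟨e, h1, h2⟩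
    refine ⟨((tensorEquiv φ M).symm.toAddEquiv.trans e).trans (tensorEquiv ψ N).toAddEquiv,
      fun f m => ?_, fun m => ?_⟩
    · change tensorEquiv ψ N (e ((tensorEquiv φ M).symm (ramify p f • m))) =
        ramify p f • tensorEquiv ψ N (e ((tensorEquiv φ M).symm m))
      rw [map_smul, h1, map_smul]
    · change tensorEquiv ψ N (e ((tensorEquiv φ M).symm (M.twistTheta φ m))) =
        N.twistTheta ψ (tensorEquiv ψ N (e ((tensorEquiv φ M).symm m)))
      obtain ⟨x, rfl⟩ := (tensorEquiv φ M).surjective m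
      rw [← tensorEquiv_theta, LinearEquiv.symm_apply_apply, ← tensorEquiv_theta,
        LinearEquiv.symm_apply_apply, h2]
  · rintro ⟨e, h1, h2⟩
    refine ⟨((tensorEquiv φ M).toAddEquiv.trans e).trans (tensorEquiv ψ N).symm.toAddEquiv,
      fun f m => ?_, fun m => ?_⟩
    · change (tensorEquiv ψ N).symm (e (tensorEquiv φ M (ramify p f • m))) =
        ramify p f • (tensorEquiv ψ N).symm (e (tensorEquiv φ M m))
      rw [map_smul, h1, map_smul]
    · change (tensorEquiv ψ N).symm (e (tensorEquiv φ M ((tensor (expTwist φ) M).theta m))) =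
        (tensor (expTwist ψ) N).theta ((tensorEquiv ψ N).symm (e (tensorEquiv φ M m)))
      rw [LinearEquiv.symm_apply_eq, tensorEquiv_theta, tensorEquiv_theta, h2,
        LinearEquiv.apply_symm_apply]

/-- `El(φ, M)` only depends on `φ` modulo `ℂ[[u]]` and up to `u ↦ ζ u` with `ζ ^ p = 1`. -/
theorem twistIso_of_modEq (hM : M.IsRegular) {ζ : ℂˣ} (hζ : ζ ^ p = 1)
    (h : ModEqPowerSeries (compMuHom ζ ψ) φ) : TwistIso p ψ M φ M := by
  -- The map `s` turns the twist by `ψ` into the twist by `ψ(ζ u)`, and is linear over `ℂ((u^p))`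
  -- because `ζ ^ p = 1`; multiplication by `g = exp (ψ(ζ u) - φ)`, up to a constant, then moves the
  -- twist to `φ`.
  obtain ⟨s, hs1, hs2⟩ := exists_monodromy M hM ζ
  obtain ⟨g, hg0, hg⟩ := exists_theta_eq_mul _ h
  refine ⟨s.trans (LinearEquiv.smulOfNeZero ℂ⸨X⸩ M g hg0).toAddEquiv, fun f m => ?_, fun m => ?_⟩
  · change g • s (ramify p f • m) = ramify p f • g • s m
    rw [hs1, compMuHom_ramify p hζ, smul_comm]
  · change g • s (M.twistTheta ψ m) = M.twistTheta φ (g • s m)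
    rw [twistTheta_smul, hg, theta_sub, twistTheta, map_add, hs1, hs2, twistTheta,
      theta_compMuHom]
    simp only [smul_add, smul_smul, sub_mul, sub_smul, mul_comm g]
    abel

end ConnSpace

/-! ### Decomposition of `ρ^+ ρ_+` into conjugates, by Fourier inversion over the `p`-th roots of
unity. -/

theorem IsPrimitiveRoot.sum_range_pow_inv_mul {p : ℕ} {ω : ℂˣ} (hω : IsPrimitiveRoot ω p)
    {k l : ℕ} (hk : k < p) (hl : l < p) :
    ∑ j ∈ Finset.range p, (((ω ^ l)⁻¹ * ω ^ k : ℂˣ) : ℂ) ^ j = if k = l then (p : ℂ) else 0 := by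
  split_ifs with h
  · simp [h]
  · have h1 : (((ω ^ l)⁻¹ * ω ^ k : ℂˣ) : ℂ) ≠ 1 := by
      rw [Units.val_eq_one.ne, Ne, inv_mul_eq_one]
      exact fun h2 => h (hω.pow_inj hk hl h2.symm)
    have h2 : (((ω ^ l)⁻¹ * ω ^ k : ℂˣ) : ℂ) ^ p = 1 := by
      rw [← Units.val_pow_eq_pow_val, mul_pow, inv_pow, ← pow_mul, ← pow_mul, mul_comm l,
        mul_comm k, pow_mul, pow_mul, hω.pow_eq_one]
      simp
    have h3 := mul_neg_geom_sum (((ω ^ l)⁻¹ * ω ^ k : ℂˣ) : ℂ) p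
    rw [h2, sub_self] at h3
    exact (mul_eq_zero.mp h3).resolve_left (sub_ne_zero.mpr h1.symm)

namespace ConnSpace

variable {p : ℕ} [NeZero p] {φ ψ χ : ℂ⸨X⸩} {M : ConnSpace.{u}} {N : ConnSpace.{v}}

/-- For `ω` a primitive `p`-th root of unity, the space `ρ^+ ρ_+ M` is the direct sum of the
conjugates of `M` by the powers of `ω`, which are all isomorphic to `M` if `M` is regular. -/
theorem exists_conjugateSum (hM : M.IsRegular) {ω : ℂˣ} (hω : IsPrimitiveRoot ω p) :
    ∃ Sg : (Fin p → M) →+ M,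
      (∀ (f : ℂ⸨X⸩) g, Sg (ramify p f • g) = ramify p f • Sg g) ∧
      (∀ φ g, Sg (fun k => M.twistTheta (compMuHom (ω ^ (k : ℕ))⁻¹ φ) (g k)) =
        M.twistTheta φ (Sg g)) ∧
      (∀ g, (∀ j : ℕ, Sg ((HahnSeries.single (j : ℤ) (1 : ℂ) : ℂ⸨X⸩) • g) = 0) → g = 0) ∧
      ∀ h : ℕ → M, ∃ g, ∀ j < p, Sg ((HahnSeries.single (j : ℤ) (1 : ℂ) : ℂ⸨X⸩) • g) = h j := by
  have hp : (p : ℂ) ≠ 0 := by exact_mod_cast NeZero.ne p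
  choose s hs1 hs2 using fun k : Fin p => exists_monodromy M hM (ω ^ (k : ℕ))
  have hs1' : ∀ k (f : ℂ⸨X⸩) m, (s k).symm (f • m) =
      compMuHom (ω ^ (k : ℕ))⁻¹ f • (s k).symm m := fun k f m => by
    rw [AddEquiv.symm_apply_eq, hs1, compMuHom_compMuHom, mul_inv_cancel, compMuHom_one,
      AddEquiv.apply_symm_apply]
  -- The sum of the `s k (g k)`. Sending `g` to `f ↦ Sg (f • g)` identifies `M^p` with the
  -- `ℂ((u^p))`-linear maps `ℂ((u)) → M`; the last two clauses are injectivity and surjectivity,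
  -- tested on powers of `u`.
  let Sg : (Fin p → M) →+ M :=
    ∑ k, (s k).toAddMonoidHom.comp (Pi.evalAddMonoidHom (fun _ : Fin p => (M : Type u)) k)
  have hSg : ∀ g, Sg g = ∑ k, s k (g k) := fun g => by
    simp [Sg, AddMonoidHom.finsetSum_apply]
  refine ⟨Sg, fun f g => ?_, fun φ g => ?_, fun g hg => ?_, fun h => ?_⟩
  · simp only [hSg, Pi.smul_apply, hs1, Finset.smul_sum]
    refine Finset.sum_congr rfl fun k _ => ?_
    rw [compMuHom_ramify p]
    rw [← pow_mul, mul_comm, pow_mul, hω.pow_eq_one, one_pow]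
  · simp only [hSg, twistTheta, map_add, hs1, hs2, theta_compMuHom, compMuHom_compMuHom,
      mul_inv_cancel, compMuHom_one, Finset.sum_add_distrib, map_sum, Finset.smul_sum]
  · funext l
    -- Fourier inversion: `s k` multiplies `u^j` by `ω^(k j)`, so orthogonality of characters
    -- isolates the component `g l`, with factor `p`.
    have h1 : ∑ j ∈ Finset.range p, (HahnSeries.single (-j : ℤ) (1 : ℂ) : ℂ⸨X⸩) •
        (s l).symm (Sg ((HahnSeries.single (j : ℤ) (1 : ℂ) : ℂ⸨X⸩) • g)) =
        (HahnSeries.single (0 : ℤ) (p : ℂ) : ℂ⸨X⸩) • g l := by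
      have h2 : ∀ j : ℕ, (HahnSeries.single (-j : ℤ) (1 : ℂ) : ℂ⸨X⸩) •
          (s l).symm (Sg ((HahnSeries.single (j : ℤ) (1 : ℂ) : ℂ⸨X⸩) • g)) =
          ∑ k : Fin p, (HahnSeries.C ((((ω ^ (l : ℕ))⁻¹ * ω ^ (k : ℕ) : ℂˣ) : ℂ) ^ j) : ℂ⸨X⸩) •
            (s l).symm (s k (g k)) := fun j => by
        rw [hSg, map_sum, Finset.smul_sum]
        refine Finset.sum_congr rfl fun k _ => ?_
        rw [Pi.smul_apply, hs1, hs1', compMuHom_compMuHom, compMuHom_single, smul_smul,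
          HahnSeries.single_mul_single, neg_add_cancel, one_mul, mul_one, zpow_natCast]
        rfl
      simp only [h2]
      rw [Finset.sum_comm, Finset.sum_eq_single l]
      · rw [← Finset.sum_smul, ← map_sum, hω.sum_range_pow_inv_mul l.2 l.2, if_pos rfl,
          AddEquiv.symm_apply_apply]
        rfl
      · intro k _ hk
        rw [← Finset.sum_smul, ← map_sum, hω.sum_range_pow_inv_mul k.2 l.2,
          if_neg (fun h => hk (Fin.ext h)), map_zero]
        exact zero_smul ℂ⸨X⸩ ((s l).symm (s k (g k)))
      · simp
    rw [Finset.sum_eq_zero (fun j _ => by rw [hg, map_zero, smul_zero])] at h1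
    have h3 : (HahnSeries.single (0 : ℤ) (p : ℂ) : ℂ⸨X⸩) ≠ 0 := by simpa using hp
    exact (smul_eq_zero.mp h1.symm).resolve_left h3
  -- The witness is the inverse Fourier transform of `h`.
  · refine ⟨fun l => ∑ j ∈ Finset.range p, (HahnSeries.single (-j : ℤ) ((p : ℂ)⁻¹) : ℂ⸨X⸩) •
      (s l).symm (h j), fun i hi => ?_⟩
    have h2 : ∀ l : Fin p, s l (((HahnSeries.single (i : ℤ) (1 : ℂ) : ℂ⸨X⸩) •
        fun l => ∑ j ∈ Finset.range p, (HahnSeries.single (-j : ℤ) ((p : ℂ)⁻¹) : ℂ⸨X⸩) •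
        (s l).symm (h j)) l) =
        ∑ j ∈ Finset.range p, (HahnSeries.single (i - j : ℤ)
          ((((ω ^ j)⁻¹ * ω ^ i : ℂˣ) : ℂ) ^ (l : ℕ) * (p : ℂ)⁻¹) : ℂ⸨X⸩) • h j := fun l => by
      rw [Pi.smul_apply, Finset.smul_sum, map_sum]
      refine Finset.sum_congr rfl fun j _ => ?_
      rw [smul_smul, HahnSeries.single_mul_single, one_mul, hs1, AddEquiv.apply_symm_apply,
        compMuHom_single, ← sub_eq_add_neg, ← Units.val_zpow_eq_zpow_val,
        ← Units.val_pow_eq_pow_val]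
      congr 4
      rw [← zpow_natCast, ← zpow_natCast, ← zpow_natCast, ← zpow_natCast, ← zpow_mul, ← zpow_neg,
        ← zpow_add, ← zpow_mul]
      congr 1
      ring
    have hsum : ∀ (a : ℤ) (x : Fin p → ℂ), ∑ l, (HahnSeries.single a (x l) : ℂ⸨X⸩) =
        HahnSeries.single a (∑ l, x l) := fun a x =>
      (map_sum (HahnSeries.single.addMonoidHom a) x Finset.univ).symm
    rw [hSg, Finset.sum_congr rfl fun l _ => h2 l, Finset.sum_comm, Finset.sum_eq_single i]
    · rw [← Finset.sum_smul, hsum, ← Finset.sum_mul,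
        Fin.sum_univ_eq_sum_range (fun l => (((ω ^ i)⁻¹ * ω ^ i : ℂˣ) : ℂ) ^ l),
        hω.sum_range_pow_inv_mul hi hi, if_pos rfl, mul_inv_cancel₀ hp, sub_self]
      exact one_smul ℂ⸨X⸩ (h i)
    · intro j hj hji
      rw [← Finset.sum_smul, hsum, ← Finset.sum_mul,
        Fin.sum_univ_eq_sum_range (fun l => (((ω ^ j)⁻¹ * ω ^ i : ℂˣ) : ℂ) ^ l),
        hω.sum_range_pow_inv_mul hi (Finset.mem_range.mp hj), if_neg hji.symm, zero_mul, map_zero]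
      exact zero_smul ℂ⸨X⸩ (h j)
    · exact fun h => absurd (Finset.mem_range.mpr hi) h

theorem smul_twistTheta_pi {ι : Type*} (χ : ι → ℂ⸨X⸩) (f : ℂ⸨X⸩) (g : ι → M) :
    (f • fun k => M.twistTheta (χ k) (g k)) =
      (fun k => M.twistTheta (χ k) ((f • g) k)) - FormalConn.theta f • g := by
  funext k
  simp only [Pi.smul_apply, Pi.sub_apply, twistTheta_smul]
  abel

/-- An isomorphism `ρ_+ (𝓔^φ ⊗ M) ≃ ρ_+ (𝓔^ψ ⊗ N)` induces an isomorphism between the sums of the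
conjugates of `𝓔^φ ⊗ M` and of `𝓔^ψ ⊗ N`. -/
theorem TwistIso.exists_conjugates_equiv (hM : M.IsRegular) (hN : N.IsRegular) {ω : ℂˣ}
    (hω : IsPrimitiveRoot ω p) (h : TwistIso p φ M ψ N) :
    ∃ F : (Fin p → M) ≃ₗ[ℂ⸨X⸩] (Fin p → N), ∀ g,
      F (fun k : Fin p => M.twistTheta (compMuHom (ω ^ (k : ℕ))⁻¹ φ) (g k)) =
        fun k : Fin p => N.twistTheta (compMuHom (ω ^ (k : ℕ))⁻¹ ψ) (F g k) := by
  obtain ⟨e, he1, he2⟩ := h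
  obtain ⟨S, hS1, hS2, hS3, hS4⟩ := exists_conjugateSum hM hω
  obtain ⟨S', hS1', hS2', hS3', hS4'⟩ := exists_conjugateSum hN hω
  have inj : ∀ g g', (∀ f : ℂ⸨X⸩, S (f • g) = S (f • g')) → g = g' := fun g g' h =>
    sub_eq_zero.mp (hS3 _ fun j => by rw [smul_sub, map_sub, h, sub_self])
  have inj' : ∀ g g', (∀ f : ℂ⸨X⸩, S' (f • g) = S' (f • g')) → g = g' := fun g g' h =>
    sub_eq_zero.mp (hS3' _ fun j => by rw [smul_sub, map_sub, h, sub_self])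
  -- Under the identification of `M^p` and `N^p` with spaces of linear maps out of `ℂ((u))`, the
  -- isomorphism sought is composition with `e`.
  have ex : ∀ g, ∃ g', ∀ f : ℂ⸨X⸩, S' (f • g') = e (S (f • g)) := fun g => by
    obtain ⟨g', hg'⟩ := hS4' fun j => e (S ((HahnSeries.single (j : ℤ) (1 : ℂ) : ℂ⸨X⸩) • g))
    refine ⟨g', fun f => ?_⟩
    obtain ⟨c, hc⟩ := exists_eq_sum_ramify p f
    rw [hc, Finset.sum_smul, Finset.sum_smul, map_sum, map_sum, map_sum]
    refine Finset.sum_congr rfl fun j hj => ?_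
    rw [mul_comm, mul_smul, mul_smul, hS1, hS1', he1, hg' j (Finset.mem_range.mp hj)]
  have ex' : ∀ g', ∃ g, ∀ f : ℂ⸨X⸩, S' (f • g') = e (S (f • g)) := fun g' => by
    obtain ⟨g, hg⟩ :=
      hS4 fun j => e.symm (S' ((HahnSeries.single (j : ℤ) (1 : ℂ) : ℂ⸨X⸩) • g'))
    refine ⟨g, fun f => ?_⟩
    obtain ⟨c, hc⟩ := exists_eq_sum_ramify p f
    rw [hc, Finset.sum_smul, Finset.sum_smul, map_sum, map_sum, map_sum]
    refine Finset.sum_congr rfl fun j hj => ?_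
    rw [mul_comm, mul_smul, mul_smul, hS1, hS1', he1, hg j (Finset.mem_range.mp hj),
      e.apply_symm_apply]
  choose F hF using ex
  choose G hG using ex'
  refine ⟨{
    toFun := F
    invFun := G
    map_add' := fun g g' => inj' _ _ fun f => by
      rw [hF, smul_add, map_add, map_add, smul_add, map_add, hF, hF]
    map_smul' := fun a g => inj' _ _ fun f => by
      rw [hF, RingHom.id_apply, smul_smul, smul_smul, hF]
    left_inv := fun g => inj _ _ fun f => e.injective (by rw [← hG, hF])
    right_inv := fun g => inj' _ _ fun f => by rw [hF, ← hG] }, fun g => inj' _ _ fun f => ?_⟩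
  change S' (f • F _) = S' (f • fun k : Fin p => N.twistTheta _ (F g k))
  rw [hF, smul_twistTheta_pi, map_sub, hS2, map_sub, he2, smul_twistTheta_pi, map_sub, hS2', hF, hF]

end ConnSpace

/-! ### Connections as modules over a ring of operators, and cancellation of powers. -/

namespace ConnSpace

/-- The free ring on `ℂ((u))` and one more generator, which acts on every space with
connection: the generators in `ℂ((u))` act by multiplication, the last one by `u ∂_u`. -/
abbrev OperatorRing : Type := FreeAlgebra ℤ (Option ℂ⸨X⸩)

/-- The action of the generators of `OperatorRing`. -/
def generatorAction (M : ConnSpace.{u}) : Option ℂ⸨X⸩ → Module.End ℤ M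
  | none => M.theta.toIntLinearMap
  | some f => (DistribSMul.toAddMonoidHom M f).toIntLinearMap

/-- The action of `OperatorRing`. -/
abbrev operatorModule (M : ConnSpace.{u}) : Module OperatorRing M :=
  Module.compHom M (FreeAlgebra.lift ℤ M.generatorAction).toRingHom

attribute [local instance] operatorModule

theorem none_smul (M : ConnSpace.{u}) (m : M) :
    (FreeAlgebra.ι ℤ none : OperatorRing) • m = M.theta m := by
  change FreeAlgebra.lift ℤ M.generatorAction (FreeAlgebra.ι ℤ none) m = _
  rw [FreeAlgebra.lift_ι_apply]
  rfl

theorem some_smul (M : ConnSpace.{u}) (f : ℂ⸨X⸩) (m : M) :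
    (FreeAlgebra.ι ℤ (some f) : OperatorRing) • m = f • m := by
  change FreeAlgebra.lift ℤ M.generatorAction (FreeAlgebra.ι ℤ (some f)) m = _
  rw [FreeAlgebra.lift_ι_apply]
  rfl

theorem map_operator_smul {P Q : Type*} [AddCommGroup P] [AddCommGroup Q] [Module OperatorRing P]
    [Module OperatorRing Q] (F : P →+ Q)
    (hF : ∀ x m, F ((FreeAlgebra.ι ℤ x : OperatorRing) • m) =
      (FreeAlgebra.ι ℤ x : OperatorRing) • F m)
    (a : OperatorRing) : ∀ m, F (a • m) = a • F m := by
  induction a using FreeAlgebra.induction with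
  | grade0 r =>
    intro m
    rw [eq_intCast, Int.cast_smul_eq_zsmul, Int.cast_smul_eq_zsmul, map_zsmul]
  | grade1 x => exact hF x
  | mul a b ha hb =>
    intro m
    rw [mul_smul, mul_smul, ha, hb]
  | add a b ha hb =>
    intro m
    rw [add_smul, add_smul, map_add, ha, hb]

/-- A subspace stable under the connection. -/
def restrictSubmodule (M : ConnSpace.{u}) (p : Submodule OperatorRing M) : Submodule ℂ⸨X⸩ M where
  carrier := p
  add_mem' := p.add_mem
  zero_mem' := p.zero_mem
  smul_mem' f m hm := by
    rw [← some_smul]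
    exact p.smul_mem _ hm

/-- Submodules over `OperatorRing` are in particular `ℂ((u))`-subspaces, so both chain conditions
follow from finite dimension. -/
theorem restrictSubmodule_strictMono (M : ConnSpace.{u}) : StrictMono M.restrictSubmodule :=
  fun _ _ h => h

theorem isArtinian_operatorRing (M : ConnSpace.{u}) [FiniteDimensional ℂ⸨X⸩ M] :
    IsArtinian OperatorRing M := M.restrictSubmodule_strictMono.wellFoundedLT

theorem isNoetherian_operatorRing (M : ConnSpace.{u}) [FiniteDimensional ℂ⸨X⸩ M] :
    IsNoetherian OperatorRing M :=
  isNoetherian_iff'.mpr M.restrictSubmodule_strictMono.wellFoundedGT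

/-- Maps that commute with `ℂ((u))` and `θ` are exactly the `OperatorRing`-linear ones, so
`LinearEquiv.nonempty_of_pi` applies. A free ring suffices: only commutation with the generators
matters, not their relations. -/
theorem isomorphic_of_pi {M : ConnSpace.{u}} {N : ConnSpace.{v}} [FiniteDimensional ℂ⸨X⸩ M]
    {n : ℕ} (hn : n ≠ 0) (F : (Fin n → M) ≃ₗ[ℂ⸨X⸩] (Fin n → N))
    (hF : ∀ g, F (fun k => M.theta (g k)) = fun k => N.theta (F g k)) : M.Isomorphic N := by
  have := isArtinian_operatorRing M
  have := isNoetherian_operatorRing M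
  have hsmul : ∀ (a : OperatorRing) m, F (a • m) = a • F m := by
    refine map_operator_smul F.toLinearMap.toAddMonoidHom fun x g => ?_
    change F _ = _ • F g
    cases x with
    | none =>
      have h1 : (FreeAlgebra.ι ℤ none : OperatorRing) • g = fun k => M.theta (g k) :=
        funext fun k => none_smul M (g k)
      rw [h1, hF]
      exact (funext fun k => none_smul N (F g k)).symm
    | some f =>
      have h1 : (FreeAlgebra.ι ℤ (some f) : OperatorRing) • g = f • g :=
        funext fun k => some_smul M f (g k)
      rw [h1, map_smul]
      exact (funext fun k => some_smul N f (F g k)).symm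
  obtain ⟨e⟩ := LinearEquiv.nonempty_of_pi (A := OperatorRing) hn
    ({ F.toAddEquiv with map_smul' := hsmul } : (Fin n → M) ≃ₗ[OperatorRing] (Fin n → N))
  have h1 : ∀ (f : ℂ⸨X⸩) m, e (f • m) = f • e m := fun f m => by
    rw [← some_smul, map_smul, some_smul]
  refine ⟨{ e with map_smul' := h1 }, fun m => ?_⟩
  change e (M.del m) = N.del (e m)
  have hu : (HahnSeries.single (1 : ℤ) (1 : ℂ) : ℂ⸨X⸩) ≠ 0 := by simp
  apply smul_right_injective N hu
  change _ • _ = N.theta (e m)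
  rw [← h1, ← theta_apply, ← none_smul, ← none_smul, map_smul]

end ConnSpace

/-! ### Blocks between sums of twists, and the part with exponents congruent to `φ`. -/

namespace ConnSpace

variable {M : ConnSpace.{u}} {N : ConnSpace.{v}} {ι : Type}

theorem twistTheta_zero (φ : ℂ⸨X⸩) : M.twistTheta φ 0 = 0 := by
  simp [twistTheta]

/-- A morphism between sums of twists of regular connections has no component between twists that
differ by a pole. -/
theorem conjugates_block_eq_zero [Fintype ι] [DecidableEq ι] (hM : M.IsRegular) (hN : N.IsRegular) (α β : ι → ℂ⸨X⸩)
    (F : (ι → M) →ₗ[ℂ⸨X⸩] (ι → N))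
    (hF : ∀ g, F (fun k => M.twistTheta (α k) (g k)) = fun k => N.twistTheta (β k) (F g k))
    {k l : ι} (h : ¬ ModEqPowerSeries (β l) (α k)) (m : M) : F (Pi.single k m) l = 0 := by
  have h1 : LinearMap.proj l ∘ₗ F ∘ₗ LinearMap.single ℂ⸨X⸩ (fun _ => (M : Type u)) k = 0 := by
    refine eq_zero_of_pole hM hN _ h _ fun m => ?_
    change F (Pi.single k (M.theta m)) l =
      N.theta (F (Pi.single k m) l) + _ • F (Pi.single k m) l
    have h2 := congrFun (hF (Pi.single k m)) l
    have h3 : (fun i => M.twistTheta (α i) ((Pi.single k m : ι → M) i)) =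
        Pi.single k (M.theta m) + FormalConn.theta (α k) • (Pi.single k m : ι → M) := by
      funext i
      by_cases hi : i = k
      · subst hi
        simp [twistTheta]
      · simp [hi, twistTheta_zero]
    rw [h3, map_add, map_smul, Pi.add_apply, Pi.smul_apply, twistTheta] at h2
    rw [FormalConn.theta_sub, sub_smul, ← add_sub_assoc, ← h2, add_sub_cancel_right]
  exact LinearMap.congr_fun h1 m

theorem conjugates_eq_zero [Fintype ι] [DecidableEq ι] (hM : M.IsRegular) (hN : N.IsRegular) (α β : ι → ℂ⸨X⸩)
    (F : (ι → M) →ₗ[ℂ⸨X⸩] (ι → N))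
    (hF : ∀ g, F (fun k => M.twistTheta (α k) (g k)) = fun k => N.twistTheta (β k) (F g k))
    (g : ι → M) (l : ι) (h : ∀ k, g k ≠ 0 → ¬ ModEqPowerSeries (β l) (α k)) : F g l = 0 := by
  have h1 : g = ∑ k, Pi.single k (g k) := (Finset.univ_sum_single g).symm
  rw [h1, map_sum, Finset.sum_apply]
  refine Finset.sum_eq_zero fun k _ => ?_
  by_cases hk : g k = 0
  · rw [hk, Pi.single_zero, map_zero, Pi.zero_apply]
  · exact conjugates_block_eq_zero hM hN α β F hF (h k hk) (g k)

theorem _root_.FormalConn.ModEqPowerSeries.trans {f g h : ℂ⸨X⸩} (hfg : ModEqPowerSeries f g)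
    (hgh : ModEqPowerSeries g h) : ModEqPowerSeries f h := by
  rw [ModEqPowerSeries, mem_range_coe_iff] at *
  intro n hn
  rw [← sub_add_sub_cancel f g h, HahnSeries.coeff_add, hfg n hn, hgh n hn, add_zero]

/-- Here `γ` plays the role of `exp (α - φ)`: multiplication by it carries the twist by `α` to the
twist by `φ`. -/
theorem smul_twistTheta_of_theta_eq {α φ γ : ℂ⸨X⸩}
    (hγ : FormalConn.theta γ = FormalConn.theta (α - φ) * γ) (m : M) :
    γ • M.twistTheta α m = M.twistTheta φ (γ • m) := by
  rw [twistTheta_smul, hγ, FormalConn.theta_sub, twistTheta, twistTheta]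
  simp only [smul_add, smul_smul, sub_mul, sub_smul, mul_comm γ]
  abel

section Isotypic

variable (M) (I : ι → Prop) (γ : ι → ℂ⸨X⸩)

/-- Extension by zero, rescaled by `γ`. -/
def extendScaled [DecidablePred I] : ({k // I k} → M) →ₗ[ℂ⸨X⸩] (ι → M) :=
  LinearMap.pi fun k => if h : I k then (γ k)⁻¹ • LinearMap.proj ⟨k, h⟩ else 0

/-- Restriction, rescaled by `γ`. -/
def restrictScaled : (ι → M) →ₗ[ℂ⸨X⸩] ({k // I k} → M) :=
  LinearMap.pi fun k => γ k • LinearMap.proj k.1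

variable {M I γ}

theorem extendScaled_apply_of_pos [DecidablePred I] (x : {k // I k} → M) (k : {k // I k}) :
    extendScaled M I γ x k = (γ k)⁻¹ • x k := by
  simp [extendScaled, k.2]

theorem extendScaled_apply_of_neg [DecidablePred I] (x : {k // I k} → M) {k : ι} (h : ¬ I k) :
    extendScaled M I γ x k = 0 := by
  simp [extendScaled, h]

theorem restrictScaled_apply (y : ι → M) (k : {k // I k}) :
    restrictScaled M I γ y k = γ k • y k := rfl

theorem restrictScaled_extendScaled [DecidablePred I] (hγ : ∀ k, γ k ≠ 0) (x : {k // I k} → M) :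
    restrictScaled M I γ (extendScaled M I γ x) = x := by
  funext k
  rw [restrictScaled_apply, extendScaled_apply_of_pos, smul_inv_smul₀ (hγ k)]

theorem extendScaled_restrictScaled [DecidablePred I] (hγ : ∀ k, γ k ≠ 0) (y : ι → M) (hy : ∀ k, ¬ I k → y k = 0) :
    extendScaled M I γ (restrictScaled M I γ y) = y := by
  funext k
  by_cases h : I k
  · rw [extendScaled_apply_of_pos _ ⟨k, h⟩, restrictScaled_apply, inv_smul_smul₀ (hγ k)]
  · rw [extendScaled_apply_of_neg _ h, hy k h]

theorem restrictScaled_twistTheta {α : ι → ℂ⸨X⸩} {φ : ℂ⸨X⸩}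
    (hγ : ∀ k, I k → FormalConn.theta (γ k) = FormalConn.theta (α k - φ) * γ k) (y : ι → M) :
    restrictScaled M I γ (fun k => M.twistTheta (α k) (y k)) =
      fun k => M.twistTheta φ (restrictScaled M I γ y k) :=
  funext fun k => smul_twistTheta_of_theta_eq (hγ k k.2) (y k)

theorem extendScaled_twistTheta [DecidablePred I] (hγ0 : ∀ k, γ k ≠ 0) {α : ι → ℂ⸨X⸩} {φ : ℂ⸨X⸩}
    (hγ : ∀ k, I k → FormalConn.theta (γ k) = FormalConn.theta (α k - φ) * γ k)
    (x : {k // I k} → M) :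
    extendScaled M I γ (fun k => M.twistTheta φ (x k)) =
      fun k => M.twistTheta (α k) (extendScaled M I γ x k) := by
  funext k
  by_cases h : I k
  · rw [extendScaled_apply_of_pos _ ⟨k, h⟩, extendScaled_apply_of_pos _ ⟨k, h⟩,
      inv_smul_eq_iff₀ (hγ0 k), smul_twistTheta_of_theta_eq (hγ k h), smul_inv_smul₀ (hγ0 k)]
  · rw [extendScaled_apply_of_neg _ h, extendScaled_apply_of_neg _ h, twistTheta_zero]

end Isotypic

/-- Congruence mod `ℂ[[u]]` is transitive, so a nonzero block from an index congruent to `φ` can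
only reach another such index. -/
theorem conjugates_extendScaled_eq_zero [Fintype ι] [DecidableEq ι] (hM : M.IsRegular) (hN : N.IsRegular) (α : ι → ℂ⸨X⸩)
    (φ : ℂ⸨X⸩) [DecidablePred fun k => ModEqPowerSeries (α k) φ] (γ : ι → ℂ⸨X⸩)
    (F : (ι → M) →ₗ[ℂ⸨X⸩] (ι → N))
    (hF : ∀ g, F (fun k => M.twistTheta (α k) (g k)) = fun k => N.twistTheta (α k) (F g k))
    (x : {k // ModEqPowerSeries (α k) φ} → M) (l : ι) (hl : ¬ ModEqPowerSeries (α l) φ) :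
    F (extendScaled M _ γ x) l = 0 := by
  refine conjugates_eq_zero hM hN α α F hF _ l fun k hk h => ?_
  by_cases hkφ : ModEqPowerSeries (α k) φ
  · exact hl (h.trans hkφ)
  · exact hk (extendScaled_apply_of_neg x hkφ)

/-- The isotypic part of an isomorphism between sums of twists. -/
theorem isomorphic_of_conjugates [Fintype ι] [DecidableEq ι] [FiniteDimensional ℂ⸨X⸩ M] (hM : M.IsRegular) (hN : N.IsRegular)
    (α : ι → ℂ⸨X⸩) (φ : ℂ⸨X⸩) {i : ι} (hi : ModEqPowerSeries (α i) φ)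
    (F : (ι → M) ≃ₗ[ℂ⸨X⸩] (ι → N))
    (hF : ∀ g, F (fun k => M.twistTheta (α k) (g k)) = fun k => N.twistTheta (α k) (F g k)) :
    M.Isomorphic N := by
  classical
  let I : ι → Prop := fun k => ModEqPowerSeries (α k) φ
  have hex : ∀ k, ∃ γ : ℂ⸨X⸩, γ ≠ 0 ∧
      (I k → FormalConn.theta γ = FormalConn.theta (α k - φ) * γ) := fun k => by
    by_cases h : I k
    · obtain ⟨γ, h1, h2⟩ := exists_theta_eq_mul _ h
      exact ⟨γ, h1, fun _ => h2⟩
    · exact ⟨1, one_ne_zero, fun h' => absurd h' h⟩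
  choose γ hγ0 hγ using hex
  have hF' : ∀ g, F.symm (fun k => N.twistTheta (α k) (g k)) =
      fun k => M.twistTheta (α k) (F.symm g k) := fun g => by
    rw [LinearEquiv.symm_apply_eq, hF, LinearEquiv.apply_symm_apply]
  -- Both `F` and `F⁻¹` preserve the vectors supported on `I`, so the block of `F` there is
  -- invertible; the scaling by `γ` gives all its summands the same twist `φ`.
  let G : ({k // I k} → M) ≃ₗ[ℂ⸨X⸩] ({k // I k} → N) := LinearEquiv.ofLinearMap
    (restrictScaled N I γ ∘ₗ F.toLinearMap ∘ₗ extendScaled M I γ)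
    (restrictScaled M I γ ∘ₗ F.symm.toLinearMap ∘ₗ extendScaled N I γ)
    (LinearMap.ext fun x => by
      change restrictScaled N I γ (F (extendScaled M I γ (restrictScaled M I γ
        (F.symm (extendScaled N I γ x))))) = x
      rw [extendScaled_restrictScaled (I := I) hγ0 (F.symm (extendScaled N I γ x))
        (conjugates_extendScaled_eq_zero hN hM α φ γ F.symm.toLinearMap hF' x),
        LinearEquiv.apply_symm_apply, restrictScaled_extendScaled hγ0])
    (LinearMap.ext fun x => by
      change restrictScaled M I γ (F.symm (extendScaled N I γ (restrictScaled N I γ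
        (F (extendScaled M I γ x))))) = x
      rw [extendScaled_restrictScaled (I := I) hγ0 (F (extendScaled M I γ x))
        (conjugates_extendScaled_eq_zero hM hN α φ γ F.toLinearMap hF x),
        LinearEquiv.symm_apply_apply, restrictScaled_extendScaled hγ0])
  -- With one common twist, `θ(φ)` acts as a scalar and drops out by linearity of `G`.
  have hG : ∀ x, G (fun k => M.theta (x k)) = fun k => N.theta (G x k) := fun x => by
    have h1 : G (fun k => M.twistTheta φ (x k)) = fun k => N.twistTheta φ (G x k) := by
      change restrictScaled N I γ (F (extendScaled M I γ _)) =
        fun k => N.twistTheta φ (restrictScaled N I γ (F (extendScaled M I γ x)) k)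
      rw [extendScaled_twistTheta hγ0 hγ, hF, restrictScaled_twistTheta hγ]
    have h2 : (fun k => M.twistTheta φ (x k)) =
        (fun k => M.theta (x k)) + FormalConn.theta φ • x := rfl
    rw [h2, map_add, map_smul] at h1
    exact add_right_cancel h1
  let ε := Fintype.equivFin {k // I k}
  have : Nonempty {k // I k} := ⟨⟨i, hi⟩⟩
  refine isomorphic_of_pi (n := Fintype.card {k // I k}) Fintype.card_ne_zero
    (LinearEquiv.funCongrLeft ℂ⸨X⸩ M ε ≪≫ₗ G ≪≫ₗ LinearEquiv.funCongrLeft ℂ⸨X⸩ N ε.symm)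
    fun g => ?_
  change (G fun k => M.theta (g (ε k))) ∘ ε.symm = fun k => N.theta (G (g ∘ ε) (ε.symm k))
  rw [hG fun k => g (ε k)]
  rfl

theorem _root_.Complex.exists_units_isPrimitiveRoot (p : ℕ) [NeZero p] :
    ∃ ω : ℂˣ, IsPrimitiveRoot ω p :=
  ⟨_, (Complex.isPrimitiveRoot_exp p (NeZero.ne p)).isUnit_unit (NeZero.ne p)⟩

/-- Otherwise every block out of the summand `k = 0`, whose exponent is `φ` itself, vanishes, and
the injective `F` kills a nonzero vector. -/
theorem TwistIso.exists_modEq {p : ℕ} [NeZero p] {φ ψ : ℂ⸨X⸩} (hM : M.IsRegular)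
    (hN : N.IsRegular) [Nontrivial M] (h : TwistIso p φ M ψ N) :
    ∃ ζ : ℂˣ, ζ ^ p = 1 ∧ ModEqPowerSeries (compMuHom ζ ψ) φ := by
  obtain ⟨ω, hω⟩ := Complex.exists_units_isPrimitiveRoot p
  obtain ⟨F, hF⟩ := h.exists_conjugates_equiv hM hN hω
  by_contra! hno
  obtain ⟨m, hm⟩ := exists_ne (0 : M)
  have h0 : F (Pi.single 0 m) = 0 := funext fun l =>
    conjugates_block_eq_zero hM hN _ _ F.toLinearMap hF (k := 0) (l := l) (fun h1 => by
      refine hno (ω ^ (l : ℕ))⁻¹ ?_ ?_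
      · rw [inv_pow, ← pow_mul, mul_comm, pow_mul, hω.pow_eq_one, one_pow, inv_one]
      · simpa [compMuHom_one] using h1) m
  rw [LinearEquiv.map_eq_zero_iff] at h0
  exact hm (by simpa using congrFun h0 0)

end ConnSpace

end

theorem lemma2p4 (p : ℕ) [NeZero p] (φ ψ : ℂ⸨X⸩) (R : ConnSpace.{u}) (S : ConnSpace.{v})
    [FiniteDimensional ℂ⸨X⸩ R] [FiniteDimensional ℂ⸨X⸩ S]
    (hR : R.IsRegular) (hS : S.IsRegular) (hRS : Nontrivial R ∨ Nontrivial S) :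
    (ConnSpace.El p φ R).Isomorphic (ConnSpace.El p ψ S) ↔
      (∃ ζ : ℂ, ζ ^ p = 1 ∧ FormalConn.ModEqPowerSeries (FormalConn.compMu ζ ψ) φ) ∧
        S.Isomorphic R := by
  rw [ConnSpace.isomorphic_El_iff]
  constructor
  · intro h
    have : Nontrivial R := by
      obtain ⟨e, -⟩ := h
      exact hRS.elim id fun _ => e.toEquiv.nontrivial
    obtain ⟨ζ, hζ, hmod⟩ := h.exists_modEq hR hS
    refine ⟨⟨ζ, by rw [← Units.val_pow_eq_pow_val, hζ, Units.val_one], hmod⟩, ?_⟩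
    -- Replaces `ψ` by `φ`, so that both sums of conjugates carry the same exponents.
    have h1 := (h.trans (ConnSpace.twistIso_of_modEq hS hζ hmod)).symm
    obtain ⟨ω, hω⟩ := Complex.exists_units_isPrimitiveRoot p
    obtain ⟨F, hF⟩ := h1.exists_conjugates_equiv hS hR hω
    -- The conjugate of index `0` is `φ`, so the class of `φ` is nonempty and a positive power of
    -- `S` is compared with that of `R`.
    refine ConnSpace.isomorphic_of_conjugates hS hR _ φ (i := 0) ?_ F hF
    refine ⟨0, ?_⟩
    simp [FormalConn.compMuHom_one]
  · rintro ⟨⟨ζ, hζ, hmod⟩, hiso⟩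
    have hζ0 : ζ ≠ 0 := fun h => by
      rw [h, zero_pow (NeZero.ne p)] at hζ
      exact zero_ne_one hζ
    have h1 : ConnSpace.TwistIso p ψ S φ S :=
      ConnSpace.twistIso_of_modEq (ζ := Units.mk0 ζ hζ0) hS (Units.ext hζ) hmod
    exact ((hiso.twistIso p φ).symm).trans h1.symm
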